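/- Let $N\ge 0$ be an integer, $c>0$, and let $\Omega=\{x\in\mathbb R^N: 0<x_1<\cdots<x_N\}$. Fix $y\in\Omega$. A signed permutation of $\{1,\dots,N\}$ is a map $\sigma:\{1,\dots,N\}\to\{-N,\dots,-1\}\cup\{1,\dots,N\}$ such that $|\sigma|$ is a permutation; $\mathbb B_N$ is the set of all of them. An inversion of $\sigma$ is a pair $(\pm\sigma(i),\sigma(j))$ with $i<j$ and $\pm\sigma(i)>\sigma(j)$ (either sign is allowed). Put $S(k)=-\dfrac{c-ik}{c+ik}$, $k_{-a}=-k_a$ for $a=1,\dots,N$, and $$A_\sigma=(-1)^{\#\{i:\sigma(i)<0\}}\prod_{\text{inversions }(a,b)\text{ of }\sigma}S(k_a-k_b).$$ For $x\in\Omega$ and real $t\ne0$ let $$\Psi_y(x;t)=\sum_{\sigma\in\mathbb B_N}\frac1{(2\pi)^N}\int_{\mathbb R}\cdots\int_{\mathbb R}A_\sigma\prod_{j=1}^Ne^{ik_{\sigma(j)}x_j}\prod_{j=1}^Ne^{-ik_jy_j}\,e^{-it\sum_jk_j^2}\,dk_1\cdots dk_N ,$$ each integral being the limit of the integrals over boxes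 $\prod_j[a_j,b_j]$ as all $a_j\to-\infty$ and all $b_j\to+\infty$ independently. Then all these limits exist, and $\Psi_y$ solves the time-dependent Schrödinger problem of the repulsive Lieb–Liniger $\delta$-Bose gas on the half-line with a hard wall at $0$ and initial condition $\prod_j\delta(x_j-y_j)$. That is, $\Psi_y$ is $C^2$ on $\Omega\times(\mathbb R\setminus\{0\})$ and: 1. $-\sum_{j=1}^N\dfrac{\partial^2\Psi_y}{\partial x_j^2}=i\,\dfrac{\partial\Psi_y}{\partial t}$ for $x\in\Omega$, $t\neq0$; 2. for $t\ne0$, $1\le j<N$ and every $z\in\overline\Omega$ with $z_{j+1}=z_j$, as $x\to z$ within $\Omega$ the function $\Psi_y(x;t)$ has a limit $v$ and $\left(\dfrac{\partial}{\partial x_{j+1}}-\dfrac{\partial}{\partial x_j}\right)\Psi_y(x;t)\to c\,v$; 3. for $t\ne0$, if $N\ge1$, then for every $z\in\overline\Omega$ with $z_1=0$ one has $\Psi_y(x;t)\to0$ as $x\to z$ within $\Omega$; 4. for every $\varphi\in C_c^\infty(\Omega)$, $\displaystyle\int_\Omega\Psi_y(x;t)\,\varphi(x)\,dx\to\varphi(y)$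 as $t\to0$, $t\neq 0$. -/

import Mathlib

open Filter Topology MeasureTheory
open scoped ContDiff

namespace HalfLineBose

noncomputable section

/-- The signed permutations of `{1, …, N}`: a permutation together with a sign for each
position. -/
abbrev SignedPerm (N : ℕ) : Type := Equiv.Perm (Fin N) × (Fin N → ℤˣ)

/-- The value `σ(i) ∈ {-N, …, -1} ∪ {1, …, N}` of a signed permutation, where the element `i` of
`Fin N` stands for the number `i + 1`. -/
def SignedPerm.entry {N : ℕ} (σ : SignedPerm N) (i : Fin N) : ℤ :=
  (σ.2 i : ℤ) * ((σ.1 i : ℕ) + 1 : ℤ)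

/-- The number `k_{σ(i)}`, with the convention `k_{-a} = -k_a`. -/
def SignedPerm.momentum {N : ℕ} (σ : SignedPerm N) (k : Fin N → ℝ) (i : Fin N) : ℝ :=
  ((σ.2 i : ℤ) : ℝ) * k (σ.1 i)

/-- The inversions `(η σ(i), σ(j))` of a signed permutation, where `η = ±1`, `i < j` and
`η σ(i) > σ(j)`; the inversion is recorded as the triple `(η, i, j)`, which determines the pair
and is determined by it. -/
def SignedPerm.inversions {N : ℕ} (σ : SignedPerm N) : Finset (ℤˣ × Fin N × Fin N) :=
  {p | p.2.1 < p.2.2 ∧ σ.entry p.2.2 < (p.1 : ℤ) * σ.entry p.2.1}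

/-- The two-body factor `S(κ) = -(c - iκ) / (c + iκ)`. -/
def scattering (c κ : ℝ) : ℂ :=
  -(((c : ℂ) - Complex.I * κ) / ((c : ℂ) + Complex.I * κ))

/-- `A_σ(k) = (-1)^{#{i : σ(i) < 0}} ∏ S(k_a - k_b)`, the product over the inversions `(a, b)`
of `σ`. -/
def amplitude {N : ℕ} (c : ℝ) (σ : SignedPerm N) (k : Fin N → ℝ) : ℂ :=
  (-1) ^ (Finset.univ.filter fun i => σ.entry i < 0).card *
    ∏ p ∈ σ.inversions,
      scattering c (((p.1 : ℤ) : ℝ) * σ.momentum k p.2.1 - σ.momentum k p.2.2)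

/-- `A_σ(k) ∏ⱼ exp(i k_{σ(j)} xⱼ) ∏ⱼ exp(-i kⱼ yⱼ) exp(-i t ∑ⱼ kⱼ²)`. -/
def integrand {N : ℕ} (c : ℝ) (σ : SignedPerm N) (y x : Fin N → ℝ) (t : ℝ)
    (k : Fin N → ℝ) : ℂ :=
  amplitude c σ k *
    (∏ j, Complex.exp (Complex.I * σ.momentum k j * x j)) *
    (∏ j, Complex.exp (-(Complex.I * k j * y j))) *
    Complex.exp (-(Complex.I * t * ∑ j, (k j : ℂ) ^ 2))

/-- The integral of the `σ`-th integrand over the box `∏ⱼ [aⱼ, bⱼ]`, where `B = (a, b)`; each of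
the `N` integrations carries the factor `1 / (2π)`. -/
def boxIntegral {N : ℕ} (c : ℝ) (σ : SignedPerm N) (y x : Fin N → ℝ) (t : ℝ)
    (B : (Fin N → ℝ) × (Fin N → ℝ)) : ℂ :=
  (1 / (2 * (Real.pi : ℂ))) ^ N * ∫ k in Set.Icc B.1 B.2, integrand c σ y x t k

/-- All lower endpoints of the box tend to `-∞` and all upper endpoints to `+∞`, independently. -/
def boxFilter (N : ℕ) : Filter ((Fin N → ℝ) × (Fin N → ℝ)) := atBot ×ˢ atTop

/-- `Ψ_y(x; t)`: the sum over the signed permutations of the (improper) `N`-fold integrals. The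
integrals over `ℝ^N` do not converge absolutely; they are limits of integrals over boxes. -/
def Psi {N : ℕ} (c : ℝ) (y x : Fin N → ℝ) (t : ℝ) : ℂ :=
  ∑ σ : SignedPerm N, limUnder (boxFilter N) (boxIntegral c σ y x t)

/-- The region `0 < x₁ < ⋯ < x_N`. -/
def chamber (N : ℕ) : Set (Fin N → ℝ) := {x | (∀ i, 0 < x i) ∧ StrictMono x}

/-- The partial derivative `∂f / ∂xⱼ`. -/
def partialDeriv {N : ℕ} (j : Fin N) (f : (Fin N → ℝ) → ℂ) (x : Fin N → ℝ) : ℂ :=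
  fderiv ℝ f x (Pi.single j 1)

/-- `u` solves, in the region `0 < x₁ < ⋯ < x_N`, the time-dependent Schrödinger equation of the
`δ`-Bose gas on the half-line, with its boundary conditions and initial condition
`∏ⱼ δ(xⱼ - yⱼ)`. Only the values of `u` at points of the region and at times `t ≠ 0` matter. -/
structure IsSolution {N : ℕ} (c : ℝ) (y : Fin N → ℝ) (u : (Fin N → ℝ) → ℝ → ℂ) : Prop where
  /-- `u` is twice continuously differentiable. -/
  regular : ContDiffOn ℝ 2 (fun p : (Fin N → ℝ) × ℝ => u p.1 p.2) (chamber N ×ˢ {0}ᶜ)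
  /-- `-∑ⱼ ∂²u/∂xⱼ² = i ∂u/∂t`. -/
  schrodinger : ∀ x ∈ chamber N, ∀ t : ℝ, t ≠ 0 →
    -∑ j, partialDeriv j (partialDeriv j fun z => u z t) x = Complex.I * deriv (u x) t
  /-- `(∂/∂xⱼ₊₁ - ∂/∂xⱼ) u = c u` where `xⱼ₊₁ = xⱼ`, in the sense of limits from the region. -/
  interaction : ∀ t : ℝ, t ≠ 0 → ∀ i j : Fin N, (j : ℕ) = i + 1 →
    ∀ z ∈ closure (chamber N), z j = z i →
      ∃ v : ℂ, Tendsto (fun x => u x t) (𝓝[chamber N] z) (𝓝 v) ∧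
        Tendsto (fun x => partialDeriv j (fun w => u w t) x - partialDeriv i (fun w => u w t) x)
          (𝓝[chamber N] z) (𝓝 (c * v))
  /-- `u = 0` where `x₁ = 0+`. -/
  hardWall : ∀ t : ℝ, t ≠ 0 → ∀ i : Fin N, (i : ℕ) = 0 →
    ∀ z ∈ closure (chamber N), z i = 0 →
      Tendsto (fun x => u x t) (𝓝[chamber N] z) (𝓝 0)
  /-- `u → ∏ⱼ δ(xⱼ - yⱼ)` as `t → 0`, as distributions on the region. -/
  initial : ∀ φ : (Fin N → ℝ) → ℂ, ContDiff ℝ ∞ φ → HasCompactSupport φ →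
    tsupport φ ⊆ chamber N →
      Tendsto (fun t : ℝ => ∫ x, u x t * φ x) (𝓝[≠] 0) (𝓝 (φ y))

end

end HalfLineBose

namespace HalfLineBose

noncomputable section

/-! For `c > 0` the two-body factor is the Fourier transform of a finite complex measure carried by
nonnegative delays: `S(κ) = ∫ e^{-iκs} (δ₀ - 2c e^{-cs} ds)` over `s ≥ 0`. Attach a delay `s_p` to
each inversion `p = (η, i, j)` of `σ`. The product of the factors `S` then becomes an average of
phases, and by `sum_mul_shift` these phases translate `x` by `-shift(s)`, where `shift(s) = ∑ s_p (η
e_i - e_j)`. Thus each Bethe wave is a signed average of free plane waves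
(`integral_twoBodyProd_mul`). Since signed permutations are orthogonal, the phase in `y` is a
further translation, by `σy`.

For fixed delays the box integral is a product of one-dimensional Fresnel integrals over intervals.
These are bounded uniformly in the endpoints and in the translation, so dominated convergence over
the delays gives the limit: `Ψ_y(x;t) = ∑_σ ± ∫ W(s) G_t(x - σy - shift(s))`, with `G_t` the free
propagator. This function, `wave`, makes sense for every `x` in `ℝ^N`, and every property is read
off from it.

Smoothness: expanding the square in the Gaussian phase exhibits the average as an elementary factor
times the Fourier transform of a measure with moments of all orders. The Schrödinger equation is
inherited from `G_t` by differentiation under the delay integral.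

Boundary conditions: replace `it` by `τ = ε + it`. The momentum integrals now converge absolutely,
and the Bethe relations apply pointwise in `k`: `σ` cancels against `σ` with the sign of its first
value changed (hard wall), or with two neighbouring values interchanged (interaction). Then `ε → 0`,
using bounds locally uniform in `τ`.

Initial condition: tested against `φ`, the free propagator tends to evaluation, with a bound uniform
in `t` and in the translation. The limit is `∑_σ ± ∫ W(s) φ(σy + shift(s))`. The crux is
`eq_one_of_mem_chamber`: nonnegative delays carry `σy` into the chamber only if `σ` is the identity.
A rearrangement argument with the vector `(1, …, N)` and its image under `σ` proves this, and only
`φ(y)` survives. -/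

/-! ### The two-body factor as a Fourier transform over delays -/

/-- The reference measure `δ₀ + ds` on `[0, ∞)` for the delays. -/
def delayMeasure : Measure ℝ := Measure.dirac 0 + volume.restrict (Set.Ioi 0)

instance : SigmaFinite delayMeasure := by unfold delayMeasure; infer_instance

/-- The density, with respect to `delayMeasure`, of the signed measure whose Fourier transform is
the two-body factor. -/
def delayWeight (c s : ℝ) : ℂ := if s = 0 then 1 else ((-(2 * c * Real.exp (-(c * s))) : ℝ) : ℂ)

lemma ae_delayMeasure_nonneg : ∀ᵐ s ∂delayMeasure, 0 ≤ s := by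
  rw [delayMeasure, ae_add_measure_iff]
  refine ⟨by simp [ae_dirac_eq], ?_⟩
  filter_upwards [ae_restrict_mem measurableSet_Ioi] with s hs using (le_of_lt hs)

lemma measurable_delayWeight (c : ℝ) : Measurable (delayWeight c) := by
  unfold delayWeight
  refine Measurable.ite (measurableSet_singleton 0) measurable_const ?_
  fun_prop

lemma one_add_pow_le_exp {b s : ℝ} (hb : 0 < b) (hs : 0 ≤ s) (m : ℕ) :
    (1 + s) ^ m ≤ (m.factorial / b ^ m * Real.exp b) * Real.exp (b * s) := by
  have h := Real.pow_div_factorial_le_exp (b * (1 + s)) (by positivity) m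
  rw [div_le_iff₀ (by positivity), mul_pow] at h
  have e : Real.exp (b * (1 + s)) = Real.exp b * Real.exp (b * s) := by
    rw [← Real.exp_add]; ring_nf
  rw [e] at h
  have hb' : 0 < b ^ m := by positivity
  calc (1 + s) ^ m = b ^ m * (1 + s) ^ m / b ^ m := by field_simp
    _ ≤ (Real.exp b * Real.exp (b * s) * m.factorial) / b ^ m := by gcongr
    _ = _ := by ring

/-- Half of the exponential rate, `c / 2`, absorbs any power. Finiteness of all moments is what
later permits smoothness and differentiation under the delay integral. -/
lemma integrable_one_add_abs_pow_mul_delayWeight {c : ℝ} (hc : 0 < c) (m : ℕ) :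
    Integrable (fun s => ((1 + |s| : ℝ) : ℂ) ^ m * delayWeight c s) delayMeasure := by
  have hmeas : Measurable (fun s : ℝ => ((1 + |s| : ℝ) : ℂ) ^ m * delayWeight c s) := by
    refine Measurable.mul ?_ (measurable_delayWeight c)
    have : Continuous (fun s : ℝ => ((1 + |s| : ℝ) : ℂ) ^ m) := by fun_prop
    exact this.measurable
  refine Integrable.add_measure (integrable_dirac (by simp)) ?_
  have hc2 : 0 < c / 2 := by positivity
  have hint := (integrableOn_exp_mul_Ioi (a := -(c / 2)) (by linarith) 0).const_mul
    (2 * c * (m.factorial / (c / 2) ^ m * Real.exp (c / 2)))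
  refine Integrable.mono' hint hmeas.aestronglyMeasurable ?_
  filter_upwards [ae_restrict_mem measurableSet_Ioi] with s hs
  have hs : 0 < s := hs
  have h := one_add_pow_le_exp hc2 hs.le m
  have e : Real.exp (c / 2 * s) * Real.exp (-(c * s)) = Real.exp (-(c / 2) * s) := by
    rw [← Real.exp_add]; ring_nf
  rw [delayWeight, if_neg hs.ne', norm_mul, norm_pow, Complex.norm_real, Complex.norm_real,
    Real.norm_eq_abs, Real.norm_eq_abs, abs_neg, abs_of_pos (show 0 < 1 + |s| by positivity),
    abs_of_pos hs, abs_of_pos (show 0 < 2 * c * Real.exp (-(c * s)) by positivity), ← e]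
  calc _ ≤ ((m.factorial / (c / 2) ^ m * Real.exp (c / 2)) * Real.exp (c / 2 * s)) *
        (2 * c * Real.exp (-(c * s))) := by gcongr
    _ = _ := by ring

/-- The atom at `0` contributes `1` and the density contributes `-2c / (c + iκ)`; their sum is
`S(κ)`. -/
lemma integral_delayWeight_mul_exp {c : ℝ} (hc : 0 < c) (κ : ℝ) :
    ∫ s, delayWeight c s * Complex.exp (-(Complex.I * κ * s)) ∂delayMeasure
      = scattering c κ := by
  have hint : Integrable (fun s : ℝ => delayWeight c s * Complex.exp (-(Complex.I * κ * s)))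
      delayMeasure := by
    refine Integrable.mul_bdd (c := 1) ?_ ?_ ?_
    · simpa using integrable_one_add_abs_pow_mul_delayWeight hc 0
    · exact (by fun_prop : Continuous fun s : ℝ =>
        Complex.exp (-(Complex.I * κ * s))).aestronglyMeasurable
    · refine ae_of_all _ fun s => ?_
      rw [Complex.norm_exp]; simp
  have hne : (c : ℂ) + Complex.I * κ ≠ 0 := by
    intro h
    have := congrArg Complex.re h
    simp at this
    exact hc.ne' this
  have hI : ∫ s in Set.Ioi (0 : ℝ), delayWeight c s * Complex.exp (-(Complex.I * κ * s)) =
      -(2 * c) / (c + Complex.I * κ) := by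
    have : ∀ s ∈ Set.Ioi (0 : ℝ), delayWeight c s * Complex.exp (-(Complex.I * κ * s)) =
        -(2 * c) * Complex.exp (-(c + Complex.I * κ) * s) := by
      intro s hs
      have hs : 0 < s := hs
      rw [delayWeight, if_neg hs.ne']
      have e : Complex.exp (-(c + Complex.I * κ) * s) =
          Complex.exp (-(c * s)) * Complex.exp (-(Complex.I * κ * s)) := by
        rw [← Complex.exp_add]; ring_nf
      rw [e]; push_cast; ring
    rw [setIntegral_congr_fun measurableSet_Ioi this, integral_const_mul,
      integral_exp_mul_complex_Ioi (by simpa using hc)]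
    field_simp
    simp
  unfold delayMeasure at hint ⊢
  rw [integral_add_measure hint.left_of_add_measure hint.right_of_add_measure,
    hI, integral_dirac, scattering, delayWeight, if_pos rfl]
  field_simp
  simp
  ring

section Multi

variable {ι : Type*} [Fintype ι]

/-- The product of the delay weights. -/
def delayWeights (c : ℝ) (s : ι → ℝ) : ℂ := ∏ p, delayWeight c (s p)

/-- The product of the delay measures. -/
abbrev delayMeasures (ι : Type*) [Fintype ι] : Measure (ι → ℝ) := Measure.pi fun _ => delayMeasure

/-- A function of the delays that dominates every polynomial of degree `1`. -/
def delaySize (s : ι → ℝ) : ℝ := ∏ p, (1 + |s p|)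

lemma one_le_delaySize (s : ι → ℝ) : 1 ≤ delaySize s :=
  Finset.one_le_prod fun p _ => by simp

lemma abs_le_delaySize (s : ι → ℝ) (p : ι) : |s p| ≤ delaySize s := by
  classical
  have : 1 + |s p| ≤ delaySize s := by
    unfold delaySize
    rw [← Finset.mul_prod_erase _ _ (Finset.mem_univ p)]
    refine le_mul_of_one_le_right (by positivity) ?_
    exact Finset.one_le_prod fun p _ => by simp
  linarith

lemma measurable_delayWeights (c : ℝ) : Measurable (delayWeights c : (ι → ℝ) → ℂ) := by
  unfold delayWeights
  exact Finset.measurable_prod _ fun p _ => (measurable_delayWeight c).comp (measurable_pi_apply p)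

/-- Being a product over the coordinates, `delaySize` leaves the integrand factorized, so the
one-dimensional moments suffice. -/
lemma integrable_delaySize_pow {c : ℝ} (hc : 0 < c) (m : ℕ) :
    Integrable (fun s : ι → ℝ => (delaySize s) ^ m * ‖delayWeights c s‖) (delayMeasures ι) := by
  have h := (Integrable.fintype_prod (ι := ι) (μ := fun _ => delayMeasure)
    (fun _ => integrable_one_add_abs_pow_mul_delayWeight hc m)).norm
  refine h.congr (ae_of_all _ fun s => ?_)
  simp only [delaySize, delayWeights, norm_prod, ← Finset.prod_pow, ← Finset.prod_mul_distrib,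
    norm_mul, norm_pow, Complex.norm_real, Real.norm_eq_abs]
  refine Finset.prod_congr rfl fun p _ => ?_
  rw [abs_of_pos (show 0 < 1 + |s p| by positivity)]

lemma integrable_delayWeights_mul {c : ℝ} (hc : 0 < c) {f : (ι → ℝ) → ℂ}
    (hf : AEStronglyMeasurable f (delayMeasures ι)) (C : ℝ) (m : ℕ)
    (hb : ∀ s, ‖f s‖ ≤ C * (delaySize s) ^ m) :
    Integrable (fun s => delayWeights c s * f s) (delayMeasures ι) := by
  refine Integrable.mono' ((integrable_delaySize_pow (ι := ι) hc m).const_mul C)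
    ((measurable_delayWeights c).aestronglyMeasurable.mul hf) (ae_of_all _ fun s => ?_)
  rw [norm_mul]
  nlinarith [mul_le_mul_of_nonneg_left (hb s) (norm_nonneg (delayWeights c s))]

lemma integrable_delayWeights {c : ℝ} (hc : 0 < c) :
    Integrable (delayWeights c) (delayMeasures ι) := by
  simpa using integrable_delayWeights_mul (ι := ι) hc (f := fun _ => 1)
    aestronglyMeasurable_const 1 0 (by simp)

lemma integral_delayWeights_mul_exp {c : ℝ} (hc : 0 < c) (κ : ι → ℝ) :
    ∫ s, delayWeights c s * Complex.exp (-(Complex.I * ∑ p, κ p * s p)) ∂delayMeasures ι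
      = ∏ p, scattering c (κ p) := by
  simp_rw [← integral_delayWeight_mul_exp hc]
  rw [← integral_fintype_prod_eq_prod]
  refine integral_congr_ae (ae_of_all _ fun s => ?_)
  simp only [delayWeights, Finset.prod_mul_distrib]
  rw [← Complex.exp_sum, Finset.sum_neg_distrib]
  push_cast
  simp only [mul_assoc, Finset.mul_sum]

end Multi

/-! ### Fresnel integrals and the one-particle propagator -/

/-- The primitive of `exp (-τ k²)`. -/
def gaussPrimitive (τ : ℂ) (x : ℝ) : ℂ := ∫ k in (0 : ℝ)..x, Complex.exp (-τ * (k : ℂ) ^ 2)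

lemma norm_exp_neg_mul_sq_le_one {τ : ℂ} (hτ : 0 ≤ τ.re) (k : ℝ) :
    ‖Complex.exp (-τ * (k : ℂ) ^ 2)‖ ≤ 1 := by
  rw [Complex.norm_exp, Real.exp_le_one_iff, ← Complex.ofReal_pow, Complex.re_mul_ofReal,
    Complex.neg_re]
  nlinarith [mul_nonneg hτ (sq_nonneg k)]

lemma intervalIntegrable_exp_neg_mul_sq (τ : ℂ) (a b : ℝ) :
    IntervalIntegrable (fun k : ℝ => Complex.exp (-τ * (k : ℂ) ^ 2)) volume a b :=
  Continuous.intervalIntegrable (by fun_prop) a b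

/-- Integration by parts against `-e^{-τk²} / (2τk)`. The boundary terms are at most `1/(2‖τ‖a) +
1/(2‖τ‖b)` and the remainder at most `1/(2‖τ‖a) - 1/(2‖τ‖b)`. Only `‖τ‖` enters, so the estimate
persists on the imaginary axis. -/
lemma norm_integral_exp_neg_mul_sq_le {τ : ℂ} (hτ : 0 ≤ τ.re) (h0 : τ ≠ 0) {a b : ℝ}
    (ha : 0 < a) (hab : a ≤ b) :
    ‖∫ k in a..b, Complex.exp (-τ * (k : ℂ) ^ 2)‖ ≤ 1 / (‖τ‖ * a) := by
  have hb : 0 < b := ha.trans_le hab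
  have hpos : ∀ k ∈ Set.uIcc a b, 0 < k := fun k hk => by
    rw [Set.uIcc_of_le hab] at hk; exact ha.trans_le hk.1
  have hτn : 0 < ‖τ‖ := norm_pos_iff.2 h0
  have hc : ContinuousOn (fun k : ℝ => Complex.exp (-τ * (k : ℂ) ^ 2) / (2 * τ * (k : ℂ) ^ 2))
      (Set.uIcc a b) := by
    refine ContinuousOn.div (by fun_prop) (by fun_prop) fun k hk => ?_
    have := (hpos k hk).ne'
    simp [h0, this]
  have hc' : ContinuousOn (fun k : ℝ => 1 / (2 * ‖τ‖ * k ^ 2)) (Set.uIcc a b) := by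
    refine ContinuousOn.div (by fun_prop) (by fun_prop) fun k hk => ?_
    have := (hpos k hk).ne'
    positivity
  have hFTC : ∫ k in a..b, (Complex.exp (-τ * (k : ℂ) ^ 2) +
      Complex.exp (-τ * (k : ℂ) ^ 2) / (2 * τ * (k : ℂ) ^ 2)) =
      -Complex.exp (-τ * (b : ℂ) ^ 2) / (2 * τ * b) -
        -Complex.exp (-τ * (a : ℂ) ^ 2) / (2 * τ * a) := by
    refine intervalIntegral.integral_eq_sub_of_hasDerivAt
      (f := fun k : ℝ => -Complex.exp (-τ * (k : ℂ) ^ 2) / (2 * τ * k)) (fun k hk => ?_)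
      ((intervalIntegrable_exp_neg_mul_sq τ a b).add hc.intervalIntegrable)
    have hk0 : (k : ℂ) ≠ 0 := by exact_mod_cast (hpos k hk).ne'
    have h1 : HasDerivAt (fun z : ℂ => -Complex.exp (-τ * z ^ 2) / (2 * τ * z))
        (Complex.exp (-τ * (k : ℂ) ^ 2) +
          Complex.exp (-τ * (k : ℂ) ^ 2) / (2 * τ * (k : ℂ) ^ 2)) k := by
      have h2 : HasDerivAt (fun z : ℂ => -τ * z ^ 2) (-τ * (2 * k)) (k : ℂ) := by
        simpa using (hasDerivAt_pow 2 (k : ℂ)).const_mul (-τ)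
      have h3 : HasDerivAt (fun z : ℂ => 2 * τ * z) (2 * τ) (k : ℂ) := by
        simpa using (hasDerivAt_id (k : ℂ)).const_mul (2 * τ)
      refine (h2.cexp.fun_neg.fun_div h3 (by simp [h0, hk0])).congr_deriv ?_
      field_simp
      ring
    exact h1.comp_ofReal
  have hFTC' : ∫ k in a..b, 1 / (2 * ‖τ‖ * k ^ 2) = 1 / (2 * ‖τ‖ * a) - 1 / (2 * ‖τ‖ * b) := by
    rw [intervalIntegral.integral_eq_sub_of_hasDerivAt
      (f := fun k : ℝ => -(1 / (2 * ‖τ‖ * k))) (fun k hk => ?_) hc'.intervalIntegrable]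
    · ring
    · have hk0 := (hpos k hk).ne'
      have h3 : HasDerivAt (fun z : ℝ => 2 * ‖τ‖ * z) (2 * ‖τ‖) k := by
        simpa using (hasDerivAt_id k).const_mul (2 * ‖τ‖)
      refine (((hasDerivAt_const k (1 : ℝ)).div h3 (by positivity)).neg).congr_deriv ?_
      field_simp
      ring
  rw [intervalIntegral.integral_add (intervalIntegrable_exp_neg_mul_sq τ a b)
    hc.intervalIntegrable] at hFTC
  have hrest : ‖∫ k in a..b, Complex.exp (-τ * (k : ℂ) ^ 2) / (2 * τ * (k : ℂ) ^ 2)‖ ≤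
      1 / (2 * ‖τ‖ * a) - 1 / (2 * ‖τ‖ * b) := by
    rw [← hFTC']
    refine intervalIntegral.norm_integral_le_of_norm_le hab (ae_of_all _ fun k _ => ?_)
      hc'.intervalIntegrable
    rw [norm_div]
    have : ‖(2 * τ * (k : ℂ) ^ 2)‖ = 2 * ‖τ‖ * k ^ 2 := by simp
    rw [this]
    gcongr
    exact norm_exp_neg_mul_sq_le_one hτ k
  have hend : ∀ x : ℝ, 0 < x → ‖-Complex.exp (-τ * (x : ℂ) ^ 2) / (2 * τ * x)‖ ≤
      1 / (2 * ‖τ‖ * x) := by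
    intro x hx
    rw [norm_div, norm_neg]
    have : ‖(2 * τ * (x : ℂ))‖ = 2 * ‖τ‖ * x := by simp [abs_of_pos hx]
    rw [this]
    gcongr
    exact norm_exp_neg_mul_sq_le_one hτ x
  rw [eq_sub_of_add_eq hFTC]
  refine (norm_sub_le _ _).trans ((add_le_add (norm_sub_le _ _) le_rfl).trans ?_)
  refine (add_le_add (add_le_add (hend b hb) (hend a ha)) hrest).trans (le_of_eq ?_)
  field_simp
  ring

lemma gaussPrimitive_neg (τ : ℂ) (x : ℝ) : gaussPrimitive τ (-x) = -gaussPrimitive τ x := by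
  have := intervalIntegral.integral_comp_neg (a := 0) (b := x)
    (fun k : ℝ => Complex.exp (-τ * (k : ℂ) ^ 2))
  simp only [Complex.ofReal_neg, neg_sq, neg_zero] at this
  rw [gaussPrimitive, gaussPrimitive, this, intervalIntegral.integral_symm]

lemma tendsto_add_mul_I (t : ℝ) :
    Tendsto (fun ε : ℝ => (ε : ℂ) + Complex.I * t) (𝓝[>] 0) (𝓝 (Complex.I * t)) := by
  have h : Continuous fun ε : ℝ => (ε : ℂ) + Complex.I * t := by fun_prop
  have := h.tendsto 0
  simp only [Complex.ofReal_zero, zero_add] at this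
  exact this.mono_left nhdsWithin_le_nhds

/-- Inversion preserves the closed right half-plane, which meets the branch cut only at `0`; the
principal square root in the propagator is therefore continuous up to imaginary `τ`. -/
lemma pi_div_mem_slitPlane {τ : ℂ} (hτ : 0 ≤ τ.re) (h0 : τ ≠ 0) :
    (Real.pi : ℂ) / τ ∈ Complex.slitPlane := by
  have hn : 0 < Complex.normSq τ := Complex.normSq_pos.2 h0
  rw [Complex.mem_slitPlane_iff, Complex.div_re, Complex.div_im]
  simp only [Complex.ofReal_re, Complex.ofReal_im, zero_mul, zero_div, add_zero, zero_sub]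
  by_cases him : τ.im = 0
  · left
    have hre : τ.re ≠ 0 := fun h => h0 (Complex.ext h him)
    have : 0 < τ.re := lt_of_le_of_ne hτ hre.symm
    have := Real.pi_pos
    positivity
  · right
    have := Real.pi_ne_zero
    simp [this, him, hn.ne']

lemma continuousAt_pi_div_cpow {τ : ℂ} (hτ : 0 ≤ τ.re) (h0 : τ ≠ 0) :
    ContinuousAt (fun z : ℂ => ((Real.pi : ℂ) / z) ^ (1 / 2 : ℂ)) τ :=
  ContinuousAt.cpow (continuousAt_const.div continuousAt_id h0) continuousAt_const
    (pi_div_mem_slitPlane hτ h0)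

lemma norm_gaussPrimitive_sub_le_of_re_pos {τ : ℂ} (hτ : 0 < τ.re) {a : ℝ} (ha : 0 < a) :
    ‖gaussPrimitive τ a - (Real.pi / τ) ^ (1 / 2 : ℂ) / 2‖ ≤ 1 / (‖τ‖ * a) := by
  have h0 : τ ≠ 0 := by rintro rfl; simp at hτ
  have hlim : Tendsto (gaussPrimitive τ) atTop (𝓝 ((Real.pi / τ) ^ (1 / 2 : ℂ) / 2)) := by
    rw [← integral_gaussian_complex_Ioi hτ]
    exact intervalIntegral_tendsto_integral_Ioi 0
      (integrable_cexp_neg_mul_sq hτ).integrableOn tendsto_id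
  have hlim' := (hlim.const_sub (gaussPrimitive τ a)).norm
  refine le_of_tendsto hlim' ?_
  filter_upwards [eventually_ge_atTop a] with b hb
  rw [gaussPrimitive, gaussPrimitive, norm_sub_rev, intervalIntegral.integral_interval_sub_left
    (intervalIntegrable_exp_neg_mul_sq τ _ _) (intervalIntegrable_exp_neg_mul_sq τ _ _)]
  exact norm_integral_exp_neg_mul_sq_le hτ.le h0 ha hb

/-- The Fresnel integral with a rate: the Gaussian case at `ε + it` has an error bound that survives
`ε → 0`. -/
lemma norm_gaussPrimitive_sub_le {t : ℝ} (ht : t ≠ 0) {a : ℝ} (ha : 0 < a) :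
    ‖gaussPrimitive (Complex.I * t) a - (Real.pi / (Complex.I * t)) ^ (1 / 2 : ℂ) / 2‖ ≤
      1 / (|t| * a) := by
  have h0 : Complex.I * (t : ℂ) ≠ 0 := by simp [ht]
  have hτ := tendsto_add_mul_I t
  have hcont : Continuous fun τ : ℂ => gaussPrimitive τ a := by
    unfold gaussPrimitive
    exact intervalIntegral.continuous_parametric_intervalIntegral_of_continuous'
      (by fun_prop) _ _
  have h1 := (hcont.tendsto (Complex.I * t)).comp hτ
  have h2 := (continuousAt_pi_div_cpow (by simp) h0).tendsto.comp hτ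
  have h3 := (h1.sub (h2.div_const 2)).norm
  have h4 : Tendsto (fun ε : ℝ => 1 / (‖(ε : ℂ) + Complex.I * t‖ * a)) (𝓝[>] 0)
      (𝓝 (1 / (‖Complex.I * (t : ℂ)‖ * a))) :=
    Tendsto.div tendsto_const_nhds (hτ.norm.mul_const a)
      (mul_pos (norm_pos_iff.2 h0) ha).ne'
  have := le_of_tendsto_of_tendsto h3 h4 (by
    filter_upwards [self_mem_nhdsWithin] with ε hε
    exact norm_gaussPrimitive_sub_le_of_re_pos (by simpa using hε) ha)
  simpa using this

lemma tendsto_gaussPrimitive_atTop {t : ℝ} (ht : t ≠ 0) :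
    Tendsto (gaussPrimitive (Complex.I * t)) atTop
      (𝓝 ((Real.pi / (Complex.I * t)) ^ (1 / 2 : ℂ) / 2)) := by
  rw [tendsto_iff_norm_sub_tendsto_zero]
  have h : Tendsto (fun a : ℝ => 1 / (|t| * a)) atTop (𝓝 0) := by
    have : 0 < |t| := abs_pos.2 ht
    simpa only [one_div] using! (tendsto_id.const_mul_atTop this).inv_tendsto_atTop
  refine squeeze_zero' (Eventually.of_forall fun _ => norm_nonneg _) ?_ h
  filter_upwards [eventually_gt_atTop 0] with a ha using norm_gaussPrimitive_sub_le ht ha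

lemma tendsto_gaussPrimitive_atBot {t : ℝ} (ht : t ≠ 0) :
    Tendsto (gaussPrimitive (Complex.I * t)) atBot
      (𝓝 (-((Real.pi / (Complex.I * t)) ^ (1 / 2 : ℂ) / 2))) := by
  have := ((tendsto_gaussPrimitive_atTop ht).comp tendsto_neg_atBot_atTop).neg
  refine this.congr fun x => ?_
  simp [gaussPrimitive_neg]

/-- On `[0, 1]` the integrand is at most `1`; beyond `1` the primitive is within `1 / |t|` of its
limit; oddness covers negative `x`. -/
lemma exists_norm_gaussPrimitive_le {t : ℝ} (ht : t ≠ 0) :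
    ∃ C, ∀ x, ‖gaussPrimitive (Complex.I * t) x‖ ≤ C := by
  set A := (Real.pi / (Complex.I * t)) ^ (1 / 2 : ℂ) / 2 with hA
  have key : ∀ x, 0 ≤ x → ‖gaussPrimitive (Complex.I * t) x‖ ≤ 1 + ‖A‖ + 1 / |t| := by
    intro x hx
    have hn : 0 ≤ ‖A‖ := norm_nonneg _
    have ht' : 0 < |t| := abs_pos.2 ht
    have ht'' : 0 ≤ 1 / |t| := by positivity
    rcases le_total x 1 with h1 | h1
    · have := intervalIntegral.norm_integral_le_of_norm_le_const (a := 0) (b := x) (C := 1)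
        (f := fun k : ℝ => Complex.exp (-(Complex.I * t) * (k : ℂ) ^ 2))
        (fun k _ => norm_exp_neg_mul_sq_le_one (by simp) k)
      rw [sub_zero, abs_of_nonneg hx] at this
      unfold gaussPrimitive
      linarith
    · have h2 := norm_gaussPrimitive_sub_le ht (show 0 < x by linarith)
      have h3 : 1 / (|t| * x) ≤ 1 / |t| := by
        apply one_div_le_one_div_of_le ht'
        nlinarith
      have h4 := norm_le_norm_add_norm_sub' (gaussPrimitive (Complex.I * t) x) A
      rw [← hA] at h2
      linarith
  refine ⟨1 + ‖A‖ + 1 / |t|, fun x => ?_⟩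
  rcases le_total 0 x with h | h
  · exact key x h
  · rw [← neg_neg x, gaussPrimitive_neg, norm_neg]
    exact key (-x) (by linarith)

/-- Completing the square. For `τ = it` the centre `u / (2t)` is real, so this is a translation of
the line and needs no contour shift. -/
lemma integral_exp_mul_exp_eq {t : ℝ} (ht : t ≠ 0) (u a b : ℝ) :
    ∫ k in a..b, Complex.exp (-(Complex.I * t) * (k : ℂ) ^ 2) * Complex.exp (Complex.I * k * u) =
      Complex.exp (-(u : ℂ) ^ 2 / (4 * (Complex.I * t))) *
        (gaussPrimitive (Complex.I * t) (b - u / (2 * t)) -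
          gaussPrimitive (Complex.I * t) (a - u / (2 * t))) := by
  rw [gaussPrimitive, gaussPrimitive, intervalIntegral.integral_interval_sub_left
    (intervalIntegrable_exp_neg_mul_sq _ _ _) (intervalIntegrable_exp_neg_mul_sq _ _ _),
    ← intervalIntegral.integral_comp_sub_right
      (fun k : ℝ => Complex.exp (-(Complex.I * t) * (k : ℂ) ^ 2)),
    ← intervalIntegral.integral_const_mul]
  refine intervalIntegral.integral_congr fun k _ => ?_
  rw [← Complex.exp_add, ← Complex.exp_add]
  congr 1
  have ht' : (t : ℂ) ≠ 0 := by exact_mod_cast ht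
  push_cast
  field_simp
  linear_combination (4 * (u : ℂ) ^ 2) * Complex.I_sq

/-- The free propagator at complex time `-iτ`. -/
def kern (τ : ℂ) (u : ℝ) : ℂ :=
  1 / (2 * Real.pi) * (Real.pi / τ) ^ (1 / 2 : ℂ) * Complex.exp (-(u : ℂ) ^ 2 / (4 * τ))

/-- The factor from completing the square is unimodular, hence one bound serves all endpoints and
all translations `u`. This is the dominating bound in the limit of the boxes. -/
lemma exists_norm_integral_exp_mul_exp_le {t : ℝ} (ht : t ≠ 0) :
    ∃ C, ∀ u a b : ℝ, ‖∫ k in a..b, Complex.exp (-(Complex.I * t) * (k : ℂ) ^ 2) *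
      Complex.exp (Complex.I * k * u)‖ ≤ C := by
  obtain ⟨C, hC⟩ := exists_norm_gaussPrimitive_le ht
  refine ⟨C + C, fun u a b => ?_⟩
  rw [integral_exp_mul_exp_eq ht, norm_mul]
  have h1 : ‖Complex.exp (-(u : ℂ) ^ 2 / (4 * (Complex.I * t)))‖ = 1 := by
    rw [show -(u : ℂ) ^ 2 / (4 * (Complex.I * t)) = ((u ^ 2 / (4 * t) : ℝ) : ℂ) * Complex.I by
      have ht' : (t : ℂ) ≠ 0 := by exact_mod_cast ht
      push_cast
      field_simp
      rw [Complex.I_sq]; ring]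
    exact Complex.norm_exp_ofReal_mul_I _
  rw [h1, one_mul]
  exact (norm_sub_le _ _).trans (add_le_add (hC _) (hC _))

lemma tendsto_integral_exp_mul_exp {t : ℝ} (ht : t ≠ 0) (u : ℝ) :
    Tendsto (fun p : ℝ × ℝ => 1 / (2 * (Real.pi : ℂ)) * ∫ k in p.1..p.2,
      Complex.exp (-(Complex.I * t) * (k : ℂ) ^ 2) * Complex.exp (Complex.I * k * u))
      (atBot ×ˢ atTop) (𝓝 (kern (Complex.I * t) u)) := by
  simp_rw [integral_exp_mul_exp_eq ht]
  have h1 := (tendsto_gaussPrimitive_atTop ht).comp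
    ((tendsto_atTop_add_const_right atTop (-(u / (2 * t))) tendsto_id).comp
      (tendsto_snd (f := (atBot : Filter ℝ))))
  have h2 := (tendsto_gaussPrimitive_atBot ht).comp
    ((tendsto_atBot_add_const_right atBot (-(u / (2 * t))) tendsto_id).comp
      (tendsto_fst (g := (atTop : Filter ℝ))))
  have h3 := ((h1.sub h2).const_mul (Complex.exp (-(u : ℂ) ^ 2 / (4 * (Complex.I * t))))).const_mul
    (1 / (2 * (Real.pi : ℂ)))
  have e : kern (Complex.I * t) u = 1 / (2 * (Real.pi : ℂ)) *
      (Complex.exp (-(u : ℂ) ^ 2 / (4 * (Complex.I * t))) *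
        ((Real.pi / (Complex.I * t)) ^ (1 / 2 : ℂ) / 2 -
          -((Real.pi / (Complex.I * t)) ^ (1 / 2 : ℂ) / 2))) := by
    rw [kern]; ring
  rw [e]
  exact h3

lemma integral_gauss_mul_exp {τ : ℂ} (hτ : 0 < τ.re) (u : ℝ) :
    ∫ k : ℝ, Complex.exp (-τ * (k : ℂ) ^ 2) * Complex.exp (Complex.I * k * u) =
      2 * Real.pi * kern τ u := by
  have := fourierIntegral_gaussian hτ (u : ℂ)
  have hpi : (Real.pi : ℂ) ≠ 0 := by exact_mod_cast Real.pi_ne_zero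
  have e : 2 * Real.pi * kern τ u =
      (Real.pi / τ) ^ (1 / 2 : ℂ) * Complex.exp (-(u : ℂ) ^ 2 / (4 * τ)) := by
    rw [kern, ← mul_assoc, ← mul_assoc, mul_one_div_cancel (by simp [hpi]), one_mul]
  rw [e, ← this]
  refine integral_congr_ae (ae_of_all _ fun k => ?_)
  simp only
  rw [mul_comm]
  ring_nf

/-! ### Signed permutations and the translations caused by delays -/

variable {N : ℕ}

namespace SignedPerm

/-- The translation of the `l`-th coordinate caused by the delays at the inversions. -/
def shift (σ : SignedPerm N) (s : σ.inversions → ℝ) (l : Fin N) : ℝ :=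
  ∑ p : σ.inversions, s p *
    ((if p.1.2.1 = l then ((p.1.1 : ℤ) : ℝ) else 0) - (if p.1.2.2 = l then 1 else 0))

/-- Duality between differences of `m` along inversions and the translation. With `m` the momenta it
turns scattering phases into a shift of `x`; with integer vectors `m` it drives the combinatorial
argument for the initial condition. -/
lemma sum_mul_shift (σ : SignedPerm N) (s : σ.inversions → ℝ) (m : Fin N → ℝ) :
    ∑ l, m l * σ.shift s l =
      ∑ p : σ.inversions, (((p.1.1 : ℤ) : ℝ) * m p.1.2.1 - m p.1.2.2) * s p := by
  simp only [shift, Finset.mul_sum]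
  rw [Finset.sum_comm]
  refine Finset.sum_congr rfl fun p _ => ?_
  have : ∀ l, m l * (s p * ((if p.1.2.1 = l then ((p.1.1 : ℤ) : ℝ) else 0) -
      (if p.1.2.2 = l then 1 else 0))) =
      (if p.1.2.1 = l then m l * s p * ((p.1.1 : ℤ) : ℝ) else 0) -
        (if p.1.2.2 = l then m l * s p else 0) := by
    intro l; split_ifs <;> ring
  simp only [this, Finset.sum_sub_distrib, Finset.sum_ite_eq, Finset.mem_univ, if_true]
  ring

lemma continuous_shift (σ : SignedPerm N) : Continuous σ.shift := by
  unfold shift; fun_prop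

lemma abs_units_eq_one (η : ℤˣ) : |((η : ℤ) : ℝ)| = 1 := by
  rcases Int.units_eq_one_or η with rfl | rfl <;> simp

lemma units_mul_self (η : ℤˣ) : ((η : ℤ) : ℝ) * ((η : ℤ) : ℝ) = 1 := by
  rcases Int.units_eq_one_or η with rfl | rfl <;> simp

lemma abs_shift_le (σ : SignedPerm N) (s : σ.inversions → ℝ) (l : Fin N) :
    |σ.shift s l| ≤ 2 * σ.inversions.card * delaySize s := by
  unfold shift
  refine (Finset.abs_sum_le_sum_abs _ _).trans ?_
  have : ∀ p ∈ (Finset.univ : Finset σ.inversions), |s p *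
      ((if p.1.2.1 = l then ((p.1.1 : ℤ) : ℝ) else 0) - (if p.1.2.2 = l then 1 else 0))| ≤
        2 * delaySize s := by
    intro p _
    rw [abs_mul, mul_comm]
    refine mul_le_mul ?_ (abs_le_delaySize s p) (abs_nonneg _) (by norm_num)
    refine (abs_sub _ _).trans ?_
    have h1 : |(if p.1.2.1 = l then ((p.1.1 : ℤ) : ℝ) else 0)| ≤ 1 := by
      split_ifs <;> simp [abs_units_eq_one]
    have h2 : |(if p.1.2.2 = l then (1 : ℝ) else 0)| ≤ 1 := by
      split_ifs <;> simp
    linarith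
  refine (Finset.sum_le_sum this).trans (le_of_eq ?_)
  simp
  ring

/-- Signed permutations act orthogonally, so the phase in `y` becomes a translation by `σ.momentum
y`. -/
lemma sum_momentum_mul_momentum (σ : SignedPerm N) (k y : Fin N → ℝ) :
    ∑ i, σ.momentum k i * σ.momentum y i = ∑ j, k j * y j := by
  rw [← Equiv.sum_comp σ.1 fun j => k j * y j]
  refine Finset.sum_congr rfl fun i _ => ?_
  unfold momentum
  linear_combination (k (σ.1 i) * y (σ.1 i)) * units_mul_self (σ.2 i)

lemma continuous_momentum (σ : SignedPerm N) (i : Fin N) :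
    Continuous fun k : Fin N → ℝ => σ.momentum k i := by
  unfold momentum; fun_prop

/-- The sign `(-1)^{#{i : σ(i) < 0}}`. -/
def sgn (σ : SignedPerm N) : ℂ := (-1) ^ (Finset.univ.filter fun i => σ.entry i < 0).card

end SignedPerm

/-- The product of the two-body factors over the inversions of `σ`. -/
def twoBodyProd (c : ℝ) (σ : SignedPerm N) (k : Fin N → ℝ) : ℂ :=
  ∏ p ∈ σ.inversions, scattering c (((p.1 : ℤ) : ℝ) * σ.momentum k p.2.1 - σ.momentum k p.2.2)

lemma amplitude_eq (c : ℝ) (σ : SignedPerm N) (k : Fin N → ℝ) :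
    amplitude c σ k = σ.sgn * twoBodyProd c σ k := rfl

lemma twoBodyProd_eq_integral {c : ℝ} (hc : 0 < c) (σ : SignedPerm N) (k : Fin N → ℝ) :
    twoBodyProd c σ k = ∫ s : σ.inversions → ℝ, delayWeights c s *
      Complex.exp (-(Complex.I * ((∑ l, σ.momentum k l * σ.shift s l : ℝ) : ℂ)))
        ∂delayMeasures σ.inversions := by
  simp_rw [SignedPerm.sum_mul_shift]
  rw [integral_delayWeights_mul_exp hc, twoBodyProd, ← Finset.prod_coe_sort]

lemma integral_prod_comp_perm (π : Equiv.Perm (Fin N)) (f : Fin N → ℝ → ℂ) :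
    ∫ k : Fin N → ℝ, ∏ i, f i (k (π i)) = ∏ i, ∫ κ, f i κ := by
  have h : ∀ k : Fin N → ℝ, ∏ i, f i (k (π i)) = ∏ j, f (π.symm j) (k j) := fun k => by
    rw [← Equiv.prod_comp π fun j => f (π.symm j) (k j)]; simp
  simp_rw [h]
  rw [integral_fintype_prod_volume_eq_prod fun j => f (π.symm j)]
  exact Equiv.prod_comp π.symm fun i => ∫ κ, f i κ

lemma integrable_prod_comp_perm (π : Equiv.Perm (Fin N)) {f : Fin N → ℝ → ℂ}
    (hf : ∀ i, Integrable (f i)) : Integrable fun k : Fin N → ℝ => ∏ i, f i (k (π i)) := by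
  have h : ∀ k : Fin N → ℝ, ∏ i, f i (k (π i)) = ∏ j, f (π.symm j) (k j) := fun k => by
    rw [← Equiv.prod_comp π fun j => f (π.symm j) (k j)]; simp
  simp_rw [h]
  exact Integrable.fintype_prod fun j => hf (π.symm j)

/-- Integrating a product of one-particle profiles against the two-body factors amounts to
averaging the product of their Fourier transforms over the delays. -/
theorem integral_twoBodyProd_mul {c : ℝ} (hc : 0 < c) (σ : SignedPerm N) {h : Fin N → ℝ → ℂ}
    (hh : ∀ i, Integrable (h i)) (d : Fin N → ℝ) :
    ∫ k : Fin N → ℝ, twoBodyProd c σ k *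
        ∏ i, h i (k (σ.1 i)) * Complex.exp (Complex.I * ((σ.momentum k i * d i : ℝ) : ℂ)) =
      ∫ s : σ.inversions → ℝ, delayWeights c s *
        ∏ i, (∫ κ : ℝ, h i κ *
          Complex.exp (Complex.I * κ * ((((σ.2 i : ℤ) : ℝ) * (d i - σ.shift s i) : ℝ) : ℂ)))
        ∂delayMeasures σ.inversions := by
  -- For fixed delays the whole phase splits over the coordinates, so the `k`-integral will
  -- factorize after Fubini.
  have hexp : ∀ (k : Fin N → ℝ) (s : σ.inversions → ℝ),
      Complex.exp (-(Complex.I * ((∑ l, σ.momentum k l * σ.shift s l : ℝ) : ℂ))) *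
        ∏ i, h i (k (σ.1 i)) * Complex.exp (Complex.I * ((σ.momentum k i * d i : ℝ) : ℂ)) =
      ∏ i, h i (k (σ.1 i)) * Complex.exp (Complex.I * ((k (σ.1 i) : ℝ) : ℂ) *
          ((((σ.2 i : ℤ) : ℝ) * (d i - σ.shift s i) : ℝ) : ℂ)) := by
    intro k s
    rw [Finset.prod_mul_distrib, Finset.prod_mul_distrib, ← Complex.exp_sum, ← Complex.exp_sum,
      mul_left_comm, ← Complex.exp_add]
    congr 2
    rw [Complex.ofReal_sum, Finset.mul_sum, ← Finset.sum_neg_distrib, ← Finset.sum_add_distrib]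
    refine Finset.sum_congr rfl fun i _ => ?_
    unfold SignedPerm.momentum
    push_cast
    ring
  have hI : Integrable (Function.uncurry fun (k : Fin N → ℝ) (s : σ.inversions → ℝ) =>
      delayWeights c s * ∏ i, h i (k (σ.1 i)) * Complex.exp (Complex.I * ((k (σ.1 i) : ℝ) : ℂ) *
          ((((σ.2 i : ℤ) : ℝ) * (d i - σ.shift s i) : ℝ) : ℂ)))
      (volume.prod (delayMeasures σ.inversions)) := by
    have h1 := (integrable_prod_comp_perm σ.1 hh).mul_prod
      (integrable_delayWeights (ι := σ.inversions) hc)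
    have hcont : Continuous fun z : (Fin N → ℝ) × (σ.inversions → ℝ) =>
        ∏ i, Complex.exp (Complex.I * ((z.1 (σ.1 i) : ℝ) : ℂ) *
          ((((σ.2 i : ℤ) : ℝ) * (d i - σ.shift z.2 i) : ℝ) : ℂ)) := by
      have := σ.continuous_shift
      fun_prop
    have h2 := h1.mul_bdd (c := 1) hcont.aestronglyMeasurable (ae_of_all _ fun z => by
      rw [norm_prod]
      refine (Finset.prod_eq_one fun i _ => ?_).le
      rw [mul_assoc, ← Complex.ofReal_mul, mul_comm]
      exact Complex.norm_exp_ofReal_mul_I _)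
    refine h2.congr (ae_of_all _ fun z => ?_)
    simp only [Function.uncurry, Finset.prod_mul_distrib]
    ring
  calc _ = ∫ k : Fin N → ℝ, ∫ s : σ.inversions → ℝ, delayWeights c s *
        ∏ i, h i (k (σ.1 i)) * Complex.exp (Complex.I * ((k (σ.1 i) : ℝ) : ℂ) *
          ((((σ.2 i : ℤ) : ℝ) * (d i - σ.shift s i) : ℝ) : ℂ))
        ∂delayMeasures σ.inversions := by
        refine integral_congr_ae (ae_of_all _ fun k => ?_)
        simp only [← hexp, ← mul_assoc]
        rw [integral_mul_const, twoBodyProd_eq_integral hc]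
    _ = _ := by
        rw [integral_integral_swap hI]
        refine integral_congr_ae (ae_of_all _ fun s => ?_)
        simp only
        rw [integral_const_mul, integral_prod_comp_perm σ.1 fun i κ => h i κ *
          Complex.exp (Complex.I * κ * ((((σ.2 i : ℤ) : ℝ) * (d i - σ.shift s i) : ℝ) : ℂ))]

/-! ### Convergence of the box integrals -/

/-- The average of `G` over the translations of its argument by the delays. -/
def delayAvg (c : ℝ) (σ : SignedPerm N) (G : (Fin N → ℝ) → ℂ) (d : Fin N → ℝ) : ℂ :=
  ∫ s : σ.inversions → ℝ, delayWeights c s * G (d - σ.shift s) ∂delayMeasures σ.inversions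

/-- The free propagator of `N` particles at complex time `-iτ`. -/
def gauss (τ : ℂ) (w : Fin N → ℝ) : ℂ := ∏ i, kern τ (w i)

lemma kern_units_mul (τ : ℂ) (η : ℤˣ) (u : ℝ) : kern τ (((η : ℤ) : ℝ) * u) = kern τ u := by
  rcases Int.units_eq_one_or η with rfl | rfl <;> simp [kern]

lemma integrand_eq (c : ℝ) (σ : SignedPerm N) (y x : Fin N → ℝ) (t : ℝ) (k : Fin N → ℝ) :
    integrand c σ y x t k = σ.sgn * (twoBodyProd c σ k *
      ∏ i, Complex.exp (-(Complex.I * t) * (k (σ.1 i) : ℂ) ^ 2) *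
        Complex.exp (Complex.I * ((σ.momentum k i * (x i - σ.momentum y i) : ℝ) : ℂ))) := by
  unfold integrand
  rw [amplitude_eq, mul_assoc, mul_assoc, mul_assoc]
  congr 2
  rw [Finset.prod_mul_distrib, ← Complex.exp_sum, ← Complex.exp_sum, ← Complex.exp_sum,
    ← Complex.exp_sum, ← Complex.exp_add, ← Complex.exp_add, ← Complex.exp_add]
  congr 1
  have h1 := congrArg (fun r : ℝ => (r : ℂ)) (σ.sum_momentum_mul_momentum k y)
  push_cast at h1
  rw [← Finset.mul_sum, Equiv.sum_comp σ.1 fun j => ((k j : ℝ) : ℂ) ^ 2, ← Finset.mul_sum]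
  simp only [Finset.sum_neg_distrib, mul_assoc, ← Finset.mul_sum]
  rw [← h1]
  push_cast
  simp only [mul_sub, Finset.sum_sub_distrib]
  ring

/-- Truncation to a box is a product of one-dimensional truncations, so it can be absorbed into the
profiles `h` of `integral_twoBodyProd_mul`. -/
lemma indicator_Icc_prod (a b k : Fin N → ℝ) (π : Equiv.Perm (Fin N)) (f : ℂ)
    (g : Fin N → ℝ → ℂ) (e : Fin N → ℂ) :
    (Set.Icc a b).indicator (fun k => f * ∏ i, g i (k (π i)) * e i) k =
      f * ∏ i, (Set.Icc (a (π i)) (b (π i))).indicator (g i) (k (π i)) * e i := by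
  by_cases hk : k ∈ Set.Icc a b
  · rw [Set.indicator_of_mem hk]
    congr 1
    refine Finset.prod_congr rfl fun i _ => ?_
    rw [Set.indicator_of_mem (Set.mem_Icc.2 ⟨hk.1 _, hk.2 _⟩)]
  · rw [Set.indicator_of_notMem hk]
    have : ∃ j, ¬ (k j ∈ Set.Icc (a j) (b j)) := by
      by_contra! h
      exact hk ⟨fun j => (h j).1, fun j => (h j).2⟩
    obtain ⟨j, hj⟩ := this
    rw [Finset.prod_eq_zero (Finset.mem_univ (π.symm j)), mul_zero]
    rw [Set.indicator_of_notMem (by simpa using hj), zero_mul]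

lemma boxIntegral_eq {c : ℝ} (hc : 0 < c) (σ : SignedPerm N) (y x : Fin N → ℝ) (t : ℝ)
    {B : (Fin N → ℝ) × (Fin N → ℝ)} (hB : B.1 ≤ B.2) :
    boxIntegral c σ y x t B = σ.sgn * ∫ s : σ.inversions → ℝ, delayWeights c s *
      ∏ i, (1 / (2 * (Real.pi : ℂ)) * ∫ κ in B.1 (σ.1 i)..B.2 (σ.1 i),
        Complex.exp (-(Complex.I * t) * (κ : ℂ) ^ 2) * Complex.exp (Complex.I * κ *
          ((((σ.2 i : ℤ) : ℝ) * (x i - σ.momentum y i - σ.shift s i) : ℝ) : ℂ)))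
        ∂delayMeasures σ.inversions := by
  have hint : ∀ i, Integrable ((Set.Icc (B.1 (σ.1 i)) (B.2 (σ.1 i))).indicator
      fun κ : ℝ => Complex.exp (-(Complex.I * t) * (κ : ℂ) ^ 2)) := fun i =>
    (integrable_indicator_iff measurableSet_Icc).2
      ((by fun_prop : Continuous fun κ : ℝ =>
        Complex.exp (-(Complex.I * t) * (κ : ℂ) ^ 2)).integrableOn_Icc)
  have key := integral_twoBodyProd_mul hc σ hint (fun i => x i - σ.momentum y i)
  unfold boxIntegral
  simp_rw [integrand_eq]
  rw [integral_const_mul, ← integral_indicator measurableSet_Icc]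
  have e1 : ∀ k : Fin N → ℝ, (Set.Icc B.1 B.2).indicator (fun k => twoBodyProd c σ k *
      ∏ i, Complex.exp (-(Complex.I * t) * (k (σ.1 i) : ℂ) ^ 2) *
        Complex.exp (Complex.I * ((σ.momentum k i * (x i - σ.momentum y i) : ℝ) : ℂ))) k =
      twoBodyProd c σ k * ∏ i, (Set.Icc (B.1 (σ.1 i)) (B.2 (σ.1 i))).indicator
        (fun κ : ℝ => Complex.exp (-(Complex.I * t) * (κ : ℂ) ^ 2)) (k (σ.1 i)) *
        Complex.exp (Complex.I * ((σ.momentum k i * (x i - σ.momentum y i) : ℝ) : ℂ)) := by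
    intro k
    rw [← indicator_Icc_prod B.1 B.2 k σ.1 _ (fun i κ =>
      Complex.exp (-(Complex.I * t) * (κ : ℂ) ^ 2))]
    by_cases hk : k ∈ Set.Icc B.1 B.2 <;> simp [hk]
  simp_rw [e1]
  rw [key, mul_left_comm, ← integral_const_mul]
  congr 1
  refine integral_congr_ae (ae_of_all _ fun s => ?_)
  simp only
  rw [mul_left_comm, Finset.prod_mul_distrib, Finset.prod_const, Finset.card_univ,
    Fintype.card_fin]
  congr 2
  refine Finset.prod_congr rfl fun i _ => ?_
  rw [intervalIntegral.integral_of_le (hB _), ← integral_Icc_eq_integral_Ioc,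
    ← integral_indicator measurableSet_Icc]
  refine integral_congr_ae (ae_of_all _ fun κ => ?_)
  simp only [Set.indicator_apply]
  split_ifs <;> simp

lemma tendsto_boxFilter_pi (π : Equiv.Perm (Fin N)) :
    Tendsto (fun (B : (Fin N → ℝ) × (Fin N → ℝ)) (i : Fin N) => (B.1 (π i), B.2 (π i)))
      (boxFilter N) (Filter.pi fun _ => atBot ×ˢ atTop) := by
  refine tendsto_pi.2 fun i => Tendsto.prodMk (tendsto_atBot.2 fun r => ?_)
    (tendsto_atTop.2 fun r => ?_)
  · have h : ∀ᶠ B in boxFilter N, B.1 ≤ fun _ => r :=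
      tendsto_fst.eventually (eventually_le_atBot _)
    filter_upwards [h] with B hB using hB (π i)
  · have h : ∀ᶠ B in boxFilter N, (fun _ => r) ≤ B.2 :=
      tendsto_snd.eventually (eventually_ge_atTop _)
    filter_upwards [h] with B hB using hB (π i)

lemma eventually_boxFilter_le : ∀ᶠ B in boxFilter N, B.1 ≤ B.2 := by
  have h1 : ∀ᶠ B in boxFilter N, B.1 ≤ 0 := tendsto_fst.eventually (eventually_le_atBot 0)
  have h2 : ∀ᶠ B in boxFilter N, 0 ≤ B.2 := tendsto_snd.eventually (eventually_ge_atTop 0)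
  filter_upwards [h1, h2] with B h h' using h.trans h'

instance : (boxFilter N).NeBot := by unfold boxFilter; infer_instance

lemma measurable_integral_exp_mul_exp (t a b : ℝ) :
    Measurable fun u : ℝ => ∫ κ in a..b, Complex.exp (-(Complex.I * t) * (κ : ℂ) ^ 2) *
      Complex.exp (Complex.I * κ * u) :=
  (intervalIntegral.continuous_parametric_intervalIntegral_of_continuous'
    (by fun_prop) a b).measurable

/-- The box integrals converge, for every `x`. -/
theorem tendsto_boxIntegral {c : ℝ} (hc : 0 < c) (σ : SignedPerm N) (y x : Fin N → ℝ) {t : ℝ}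
    (ht : t ≠ 0) :
    Tendsto (boxIntegral c σ y x t) (boxFilter N)
      (𝓝 (σ.sgn * delayAvg c σ (gauss (Complex.I * t)) (x - σ.momentum y))) := by
  let u : (σ.inversions → ℝ) → Fin N → ℝ := fun s i =>
    ((σ.2 i : ℤ) : ℝ) * (x i - σ.momentum y i - σ.shift s i)
  have hu : ∀ i, Measurable fun s => u s i := fun i => by
    have := σ.continuous_shift
    exact (by fun_prop : Continuous fun s => u s i).measurable
  let F : (Fin N → ℝ × ℝ) → (σ.inversions → ℝ) → ℂ := fun p s => delayWeights c s *
      ∏ i, (1 / (2 * (Real.pi : ℂ)) * ∫ κ in (p i).1..(p i).2,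
        Complex.exp (-(Complex.I * t) * (κ : ℂ) ^ 2) * Complex.exp (Complex.I * κ * (u s i : ℂ)))
  obtain ⟨C, hC⟩ := exists_norm_integral_exp_mul_exp_le ht
  have hlim : Tendsto (fun p => ∫ s, F p s ∂delayMeasures σ.inversions)
      (Filter.pi fun _ => atBot ×ˢ atTop) (𝓝 (∫ s, delayWeights c s *
        ∏ i, kern (Complex.I * t) (u s i) ∂delayMeasures σ.inversions)) := by
    -- `C` depends neither on the endpoints nor on the delays, so integrability of the weights alone
    -- dominates.
    refine tendsto_integral_filter_of_dominated_convergence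
      (fun s => ‖delayWeights c s‖ * ∏ _i : Fin N, (‖1 / (2 * (Real.pi : ℂ))‖ * C))
      (Eventually.of_forall fun p => ?_) (Eventually.of_forall fun p => ae_of_all _ fun s => ?_)
      ((integrable_delayWeights hc).norm.mul_const _) (ae_of_all _ fun s => ?_)
    · refine ((measurable_delayWeights c).mul
        (Finset.measurable_prod _ fun i _ => ?_)).aestronglyMeasurable
      exact ((measurable_integral_exp_mul_exp t _ _).comp (hu i)).const_mul _
    · rw [norm_mul, norm_prod]
      refine mul_le_mul_of_nonneg_left (Finset.prod_le_prod (fun _ _ => norm_nonneg _)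
        fun i _ => ?_) (norm_nonneg _)
      rw [norm_mul]
      exact mul_le_mul_of_nonneg_left (hC _ _ _) (norm_nonneg _)
    · refine Tendsto.const_mul _ (tendsto_finsetProd _ fun i _ => ?_)
      exact (tendsto_integral_exp_mul_exp ht (u s i)).comp (tendsto_eval_pi _ i)
  have h2 := (hlim.comp (tendsto_boxFilter_pi σ.1)).const_mul σ.sgn
  have e : σ.sgn * delayAvg c σ (gauss (Complex.I * t)) (x - σ.momentum y) =
      σ.sgn * ∫ s, delayWeights c s *
        ∏ i, kern (Complex.I * t) (u s i) ∂delayMeasures σ.inversions := by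
    simp only [delayAvg, gauss, u, kern_units_mul, Pi.sub_apply]
  rw [e]
  refine h2.congr' ?_
  filter_upwards [eventually_boxFilter_le] with B hB
  rw [boxIntegral_eq hc σ y x t hB]
  rfl

/-- The sum over the signed permutations of the free evolutions averaged over the delays. -/
def wave (c : ℝ) (y x : Fin N → ℝ) (t : ℝ) : ℂ :=
  ∑ σ : SignedPerm N, σ.sgn * delayAvg c σ (gauss (Complex.I * t)) (x - σ.momentum y)

theorem Psi_eq_wave {c : ℝ} (hc : 0 < c) (y x : Fin N → ℝ) {t : ℝ} (ht : t ≠ 0) :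
    Psi c y x t = wave c y x t :=
  Finset.sum_congr rfl fun σ _ => (tendsto_boxIntegral hc σ y x ht).limUnder_eq

/-! ### Joint smoothness in position and time -/

/-- The normalization of the one-particle propagator. -/
def kernPre (τ : ℂ) : ℂ := 1 / (2 * Real.pi) * (Real.pi / τ) ^ (1 / 2 : ℂ)

lemma gauss_eq (τ : ℂ) (w : Fin N → ℝ) :
    gauss τ w = kernPre τ ^ N * Complex.exp (-((∑ i, w i ^ 2 : ℝ) : ℂ) / (4 * τ)) := by
  simp only [gauss, kern, kernPre, Finset.prod_mul_distrib, Finset.prod_const, Finset.card_univ,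
    Fintype.card_fin]
  rw [← Complex.exp_sum, mul_pow]
  congr 2
  push_cast
  rw [← Finset.sum_neg_distrib, Finset.sum_div]

lemma continuousAt_kernPre {τ : ℂ} (hτ : 0 ≤ τ.re) (h0 : τ ≠ 0) : ContinuousAt kernPre τ :=
  continuousAt_const.mul (continuousAt_pi_div_cpow hτ h0)

lemma contDiffAt_kernPre_I_mul {t : ℝ} (ht : t ≠ 0) :
    ContDiffAt ℝ ∞ (fun t : ℝ => kernPre (Complex.I * t)) t := by
  have h0 : Complex.I * (t : ℂ) ≠ 0 := by simp [ht]
  have hmem := pi_div_mem_slitPlane (τ := Complex.I * t) (by simp) h0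
  have hof : ContDiffAt ℝ ∞ (fun t : ℝ => (t : ℂ)) t := Complex.ofRealCLM.contDiff.contDiffAt
  have h1 : ContDiffAt ℝ ∞ (fun t : ℝ => (Real.pi : ℂ) * (Complex.I * t)⁻¹) t :=
    contDiffAt_const.mul (ContDiffAt.inv (contDiffAt_const.mul hof) h0)
  have h2 : ContDiffAt ℝ ∞ (fun t : ℝ => Complex.log ((Real.pi : ℂ) * (Complex.I * t)⁻¹)) t :=
    ContDiffAt.comp (g := Complex.log) t
      ((Complex.contDiffAt_log (n := ∞) (by rwa [← div_eq_mul_inv])).restrict_scalars ℝ) h1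
  have h3 : ContDiffAt ℝ ∞ (fun t : ℝ => 1 / (2 * (Real.pi : ℂ)) *
      Complex.exp (Complex.log ((Real.pi : ℂ) * (Complex.I * t)⁻¹) * (1 / 2 : ℂ))) t :=
    contDiffAt_const.mul (h2.mul contDiffAt_const).cexp
  refine h3.congr_of_eventuallyEq ?_
  filter_upwards [isOpen_ne.mem_nhds ht] with r hr
  have : (r : ℂ) ≠ 0 := by exact_mod_cast hr
  rw [kernPre, Complex.cpow_def_of_ne_zero (by simp [this, Real.pi_ne_zero]), ← div_eq_mul_inv]

namespace SignedPerm

lemma norm_shift_le (σ : SignedPerm N) (s : σ.inversions → ℝ) :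
    ‖σ.shift s‖ ≤ 2 * σ.inversions.card * delaySize s := by
  have := one_le_delaySize s
  exact (pi_norm_le_iff_of_nonneg (by positivity)).2 fun l => σ.abs_shift_le s l

lemma one_add_norm_sub_shift_le (σ : SignedPerm N) (s : σ.inversions → ℝ) (d : Fin N → ℝ) :
    1 + ‖d - σ.shift s‖ ≤ (1 + ‖d‖ + 2 * σ.inversions.card) * delaySize s := by
  have h1 := one_le_delaySize s
  have h2 := σ.norm_shift_le s
  have h3 := norm_sub_le d (σ.shift s)
  nlinarith [norm_nonneg d, mul_nonneg (show 0 ≤ 1 + ‖d‖ by positivity) (sub_nonneg.2 h1)]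

end SignedPerm

/-- The phase of the propagator is bilinear in this vector and in functions of position and time. -/
def phaseVec (σ : SignedPerm N) (s : σ.inversions → ℝ) :
    ℝ × (Fin N → ℝ) × (σ.inversions → ℝ) := (∑ i, σ.shift s i ^ 2, σ.shift s, s)

/-- The pairing that gives the phase of the propagator. -/
def phasePairing (N : ℕ) (ι : Type*) [Fintype ι] :
    (ℝ × (Fin N → ℝ) × (ι → ℝ)) →L[ℝ] (ℝ × (Fin N → ℝ)) →L[ℝ] ℝ :=
  IsBilinearMap.toContinuousBilinearMap (𝕜 := ℝ)
    (f := fun (v : ℝ × (Fin N → ℝ) × (ι → ℝ)) (w : ℝ × (Fin N → ℝ)) =>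
      -(v.1 * w.1) + ∑ i, w.2 i * v.2.1 i)
    { add_left := fun x x' y => by
        simp [mul_add, add_mul, Finset.sum_add_distrib]; ring
      smul_left := fun a x y => by
        simp [mul_add, Finset.mul_sum, mul_assoc, mul_left_comm]
      add_right := fun x y y' => by
        simp [mul_add, add_mul, Finset.sum_add_distrib]; ring
      smul_right := fun a x y => by
        simp [mul_add, Finset.mul_sum, mul_assoc, mul_left_comm] }

lemma continuous_phaseVec (σ : SignedPerm N) : Continuous (phaseVec σ) := by
  have := σ.continuous_shift
  unfold phaseVec
  fun_prop

lemma exists_norm_phaseVec_le (σ : SignedPerm N) :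
    ∃ C, 0 ≤ C ∧ ∀ s, ‖phaseVec σ s‖ ≤ C * delaySize s ^ 2 := by
  set M : ℝ := 2 * σ.inversions.card with hM
  have hM0 : 0 ≤ M := by positivity
  refine ⟨N * M ^ 2 + M + 1, by positivity, fun s => ?_⟩
  have h1 := one_le_delaySize s
  have h1' : delaySize s ≤ delaySize s ^ 2 := by nlinarith
  have hN : (0 : ℝ) ≤ N * M ^ 2 := by positivity
  have hq : ‖∑ i, σ.shift s i ^ 2‖ ≤ N * M ^ 2 * delaySize s ^ 2 := by
    refine (norm_sum_le _ _).trans ?_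
    have : ∀ i ∈ (Finset.univ : Finset (Fin N)), ‖σ.shift s i ^ 2‖ ≤ (M * delaySize s) ^ 2 := by
      intro i _
      rw [norm_pow, Real.norm_eq_abs]
      exact pow_le_pow_left₀ (abs_nonneg _) (σ.abs_shift_le s i) 2
    refine (Finset.sum_le_sum this).trans (le_of_eq ?_)
    simp; ring
  have hs : ‖s‖ ≤ delaySize s :=
    (pi_norm_le_iff_of_nonneg (by linarith)).2 fun p => abs_le_delaySize s p
  have hv := σ.norm_shift_le s
  rw [← hM] at hv
  have hQ : 0 ≤ delaySize s ^ 2 := by positivity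
  have hMQ : M * delaySize s ≤ M * delaySize s ^ 2 := mul_le_mul_of_nonneg_left h1' hM0
  simp only [phaseVec, norm_prod_le_iff]
  refine ⟨hq.trans ?_, hv.trans ?_, hs.trans ?_⟩ <;>
    nlinarith [mul_nonneg hN hQ, mul_nonneg hM0 hQ]

/-- Finite moments of all orders make a Fourier transform smooth. `phaseVec` grows quadratically in
the delays, whence the exponent `2 * n`. Its last component, ignored by the pairing, keeps `s`
recoverable so that the weight is a function on the image. -/
lemma contDiff_fourierIntegral_phaseVec {c : ℝ} (hc : 0 < c) (σ : SignedPerm N) :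
    ContDiff ℝ ∞ (VectorFourier.fourierIntegral Real.fourierChar
      ((delayMeasures σ.inversions).map (phaseVec σ))
      (phasePairing N σ.inversions).toLinearMap₁₂ fun v => delayWeights c v.2.2) := by
  refine VectorFourier.contDiff_fourierIntegral _ fun n _ => ?_
  have hm : Measurable fun v : ℝ × (Fin N → ℝ) × (σ.inversions → ℝ) =>
      ‖v‖ ^ n * ‖(delayWeights c v.2.2 : ℂ)‖ :=
    (measurable_norm.pow_const n).mul
      ((measurable_delayWeights c).comp (measurable_snd.comp measurable_snd)).norm
  rw [integrable_map_measure hm.aestronglyMeasurable (continuous_phaseVec σ).aemeasurable]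
  obtain ⟨C, hC0, hC⟩ := exists_norm_phaseVec_le σ
  refine Integrable.mono' ((integrable_delaySize_pow (ι := σ.inversions) hc (2 * n)).const_mul
    (C ^ n)) (hm.comp (continuous_phaseVec σ).measurable).aestronglyMeasurable
    (ae_of_all _ fun s => ?_)
  have h := pow_le_pow_left₀ (norm_nonneg _) (hC s) n
  simp only [Function.comp_apply, norm_mul, norm_pow, norm_norm]
  rw [mul_pow, ← pow_mul] at h
  rw [← mul_assoc]
  exact mul_le_mul_of_nonneg_right h (norm_nonneg _)

/-- Expand `|d - shift|² = |d|² - 2 d·shift + |shift|²` in the phase `|·|² / (4t)`. The first term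
leaves the integral and the others are linear in `phaseVec`. As the character is `e^{2πi·}`, the
coefficients `1/(4t)` and `d/(2t)` become `1/(8πt)` and `d/(4πt)`. -/
lemma delayAvg_gauss_eq (c : ℝ) (σ : SignedPerm N) (d : Fin N → ℝ) {t : ℝ} (ht : t ≠ 0) :
    delayAvg c σ (gauss (Complex.I * t)) d =
      kernPre (Complex.I * t) ^ N *
        Complex.exp (Complex.I * ((∑ i, d i ^ 2) / (4 * t) : ℝ)) *
        VectorFourier.fourierIntegral Real.fourierChar
          ((delayMeasures σ.inversions).map (phaseVec σ))
          (phasePairing N σ.inversions).toLinearMap₁₂ (fun v => delayWeights c v.2.2)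
          ((8 * Real.pi * t)⁻¹, fun i => d i * (4 * Real.pi * t)⁻¹) := by
  have hm : AEStronglyMeasurable (fun v : ℝ × (Fin N → ℝ) × (σ.inversions → ℝ) =>
      (Real.fourierChar (-(phasePairing N σ.inversions).toLinearMap₁₂ v
        ((8 * Real.pi * t)⁻¹, fun i => d i * (4 * Real.pi * t)⁻¹))) •
        (delayWeights c v.2.2 : ℂ)) ((delayMeasures σ.inversions).map (phaseVec σ)) := by
    have hcont : Continuous fun v : ℝ × (Fin N → ℝ) × (σ.inversions → ℝ) =>
        phasePairing N σ.inversions v ((8 * Real.pi * t)⁻¹, fun i => d i * (4 * Real.pi * t)⁻¹) :=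
      (phasePairing N σ.inversions).continuous.clm_apply continuous_const
    exact (Real.continuous_fourierChar.comp hcont.neg).aestronglyMeasurable.smul
      ((measurable_delayWeights c).comp (measurable_snd.comp measurable_snd)).aestronglyMeasurable
  rw [VectorFourier.fourierIntegral, integral_map (continuous_phaseVec σ).aemeasurable
    hm, ← integral_const_mul, delayAvg]
  refine integral_congr_ae (ae_of_all _ fun s => ?_)
  simp only
  rw [gauss_eq, Circle.smul_def, Real.fourierChar_apply, smul_eq_mul]
  rw [show ∀ a b e f : ℂ, a * b * (e * f) = f * (a * (b * e)) by intros; ring, ← Complex.exp_add]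
  congr 3
  have hp : ∀ v w, (phasePairing N σ.inversions).toLinearMap₁₂ v w =
      -(v.1 * w.1) + ∑ i, w.2 i * v.2.1 i := fun _ _ => rfl
  rw [hp]
  have e : ∑ i, (d - σ.shift s) i ^ 2 = ∑ i, d i ^ 2 - 2 * ∑ i, d i * σ.shift s i +
      ∑ i, σ.shift s i ^ 2 := by
    rw [Finset.mul_sum, ← Finset.sum_sub_distrib, ← Finset.sum_add_distrib]
    exact Finset.sum_congr rfl fun i _ => by rw [Pi.sub_apply]; ring
  have e' : ∑ i, d i * (4 * Real.pi * t)⁻¹ * σ.shift s i =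
      (4 * Real.pi * t)⁻¹ * ∑ i, d i * σ.shift s i := by
    rw [Finset.mul_sum]
    exact Finset.sum_congr rfl fun i _ => by ring
  simp only [phaseVec]
  rw [e, e']
  generalize ∑ i, d i ^ 2 = A
  generalize ∑ i, d i * σ.shift s i = B
  generalize ∑ i, σ.shift s i ^ 2 = D
  have ht' : (t : ℂ) ≠ 0 := by exact_mod_cast ht
  have hpi : (Real.pi : ℂ) ≠ 0 := by exact_mod_cast Real.pi_ne_zero
  push_cast
  field_simp
  ring_nf
  simp only [Complex.I_sq]
  ring

lemma contDiffOn_delayAvg_gauss {c : ℝ} (hc : 0 < c) (σ : SignedPerm N) (b : Fin N → ℝ) :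
    ContDiffOn ℝ ∞ (fun p : (Fin N → ℝ) × ℝ =>
      delayAvg c σ (gauss (Complex.I * p.2)) (p.1 - b)) (Set.univ ×ˢ {0}ᶜ) := by
  intro p hp
  have ht : p.2 ≠ 0 := hp.2
  refine ContDiffWithinAt.congr (f := fun p : (Fin N → ℝ) × ℝ => _) ?_
    (fun q hq => delayAvg_gauss_eq c σ (q.1 - b) hq.2) (delayAvg_gauss_eq c σ (p.1 - b) ht)
  refine ContDiffAt.contDiffWithinAt ?_
  have hsnd : ContDiffAt ℝ ∞ (fun q : (Fin N → ℝ) × ℝ => q.2) p := contDiffAt_snd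
  have hd : ∀ i, ContDiffAt ℝ ∞ (fun q : (Fin N → ℝ) × ℝ => (q.1 - b) i) p := fun i => by
    simp only [Pi.sub_apply]; fun_prop
  refine ContDiffAt.mul (ContDiffAt.mul ?_ ?_) ?_
  · exact (ContDiffAt.comp (g := fun t : ℝ => kernPre (Complex.I * t)) p
      (contDiffAt_kernPre_I_mul ht) hsnd).pow N
  · refine (contDiffAt_const.mul (Complex.ofRealCLM.contDiff.contDiffAt.comp p ?_)).cexp
    exact ContDiffAt.div (ContDiffAt.sum fun i _ => (hd i).pow 2)
      (contDiffAt_const.mul hsnd) (by simpa using ht)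
  · refine ContDiffAt.comp (g := VectorFourier.fourierIntegral _ _ _ _) p
      (contDiff_fourierIntegral_phaseVec hc σ).contDiffAt (ContDiffAt.prodMk ?_ ?_)
    · exact ContDiffAt.inv (contDiffAt_const.mul hsnd) (by simpa [Real.pi_ne_zero] using ht)
    · exact contDiffAt_pi.2 fun i => (hd i).mul
        (ContDiffAt.inv (contDiffAt_const.mul hsnd) (by simpa [Real.pi_ne_zero] using ht))

theorem contDiffOn_wave {c : ℝ} (hc : 0 < c) (y : Fin N → ℝ) :
    ContDiffOn ℝ ∞ (fun p : (Fin N → ℝ) × ℝ => wave c y p.1 p.2) (Set.univ ×ˢ {0}ᶜ) :=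
  ContDiffOn.sum fun σ _ => contDiffOn_const.mul (contDiffOn_delayAvg_gauss hc σ _)

lemma contDiff_delayAvg_gauss {c : ℝ} (hc : 0 < c) (σ : SignedPerm N) (b : Fin N → ℝ) {t : ℝ}
    (ht : t ≠ 0) : ContDiff ℝ ∞ fun x => delayAvg c σ (gauss (Complex.I * t)) (x - b) := by
  rw [← contDiffOn_univ]
  exact (contDiffOn_delayAvg_gauss hc σ b).comp (f := fun x => (x, t))
    (contDiff_id.prodMk contDiff_const).contDiffOn fun x _ => ⟨trivial, ht⟩

/-! ### Derivatives under the delay integral and the Schrödinger equation -/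

/-- The `j`-th unit vector. -/
def unitVec (j : Fin N) : Fin N → ℝ := Pi.single j 1

/-- The partial derivative of the propagator in the `j`-th coordinate. -/
def gaussD (τ : ℂ) (j : Fin N) (w : Fin N → ℝ) : ℂ := -((w j : ℂ) / (2 * τ)) * gauss τ w

/-- The second partial derivative of the propagator in the `j`-th coordinate. -/
def gaussDD (τ : ℂ) (j : Fin N) (w : Fin N → ℝ) : ℂ :=
  ((w j : ℂ) ^ 2 / (4 * τ ^ 2) - 1 / (2 * τ)) * gauss τ w

lemma continuous_gauss (τ : ℂ) : Continuous (gauss τ : (Fin N → ℝ) → ℂ) := by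
  unfold gauss kern; fun_prop

lemma continuous_gaussD (τ : ℂ) (j : Fin N) : Continuous (gaussD τ j) := by
  have := continuous_gauss (N := N) τ
  unfold gaussD; fun_prop

lemma continuous_gaussDD (τ : ℂ) (j : Fin N) : Continuous (gaussDD τ j) := by
  have := continuous_gauss (N := N) τ
  unfold gaussDD; fun_prop

lemma norm_gauss_le {τ : ℂ} (hτ : 0 ≤ τ.re) (w : Fin N → ℝ) : ‖gauss τ w‖ ≤ ‖kernPre τ‖ ^ N := by
  rw [gauss_eq, norm_mul, norm_pow]
  refine mul_le_of_le_one_right (by positivity) ?_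
  rw [Complex.norm_exp, Real.exp_le_one_iff, ← Complex.ofReal_neg, Complex.div_re]
  have h4 : (4 * τ).re = 4 * τ.re := by simp
  rw [h4]
  simp only [Complex.ofReal_re, Complex.ofReal_im, zero_mul, zero_div, add_zero]
  have : 0 ≤ ∑ i, w i ^ 2 := Finset.sum_nonneg fun i _ => sq_nonneg _
  have hn := Complex.normSq_nonneg (4 * τ)
  refine div_nonpos_of_nonpos_of_nonneg ?_ hn
  nlinarith [mul_nonneg this hτ]

/-- Bounds for the propagator and its derivatives, locally uniform in complex time. -/
lemma exists_gauss_bounds (N : ℕ) {τ₀ : ℂ} (hτ₀ : 0 ≤ τ₀.re) (h0 : τ₀ ≠ 0) :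
    ∃ C, 0 ≤ C ∧ ∀ᶠ τ in 𝓝 τ₀, 0 ≤ τ.re → ∀ w : Fin N → ℝ,
      ‖gauss τ w‖ ≤ C ∧ ∀ j, ‖gaussD τ j w‖ ≤ C * (1 + ‖w‖) ^ 2 ∧
        ‖gaussDD τ j w‖ ≤ C * (1 + ‖w‖) ^ 2 := by
  -- The margins `+ 1` make the bounds valid near `τ₀`; `0 ≤ τ.re` keeps the exponential at most
  -- `1`.
  set A : ℝ := (‖kernPre τ₀‖ + 1) ^ N with hA
  set B : ℝ := ‖τ₀⁻¹‖ + 1 with hB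
  have hA0 : 0 ≤ A := by positivity
  have hB1 : 1 ≤ B := by simp [hB]
  refine ⟨A * B ^ 2, by positivity, ?_⟩
  have h1 : ∀ᶠ τ in 𝓝 τ₀, ‖kernPre τ‖ < ‖kernPre τ₀‖ + 1 :=
    (continuousAt_kernPre hτ₀ h0).norm.eventually (eventually_lt_nhds (lt_add_one _))
  have h2 : ∀ᶠ τ : ℂ in 𝓝 τ₀, ‖τ⁻¹‖ < B :=
    (continuousAt_inv₀ h0).norm.eventually (eventually_lt_nhds (lt_add_one _))
  filter_upwards [h1, h2] with τ hτ1 hτ2 hre w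
  have hg : ‖gauss τ w‖ ≤ A :=
    (norm_gauss_le hre w).trans (pow_le_pow_left₀ (norm_nonneg _) hτ1.le N)
  have hB2 : B ≤ B ^ 2 := by nlinarith
  have hw0 := norm_nonneg w
  refine ⟨hg.trans (by nlinarith), fun j => ?_⟩
  have hwj : |w j| ≤ ‖w‖ := norm_le_pi_norm w j
  have hn0 := norm_nonneg τ⁻¹
  have e1 : ‖((w j : ℂ) / (2 * τ))‖ ≤ B ^ 2 * (1 + ‖w‖) ^ 2 := by
    have : ‖((w j : ℂ) / (2 * τ))‖ = |w j| * ‖τ⁻¹‖ / 2 := by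
      rw [norm_div, norm_mul, norm_inv]; simp; ring
    rw [this]
    have h5 : |w j| * ‖τ⁻¹‖ ≤ (1 + ‖w‖) ^ 2 * B ^ 2 := by
      refine mul_le_mul (by nlinarith) (by linarith) hn0 (by positivity)
    have : 0 ≤ |w j| * ‖τ⁻¹‖ := by positivity
    linarith
  have e2 : ‖((w j : ℂ) ^ 2 / (4 * τ ^ 2) - 1 / (2 * τ))‖ ≤ B ^ 2 * (1 + ‖w‖) ^ 2 := by
    refine (norm_sub_le _ _).trans ?_
    have e3 : ‖((w j : ℂ) ^ 2 / (4 * τ ^ 2))‖ = |w j| ^ 2 * ‖τ⁻¹‖ ^ 2 / 4 := by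
      rw [norm_div, norm_mul, norm_inv]; simp; ring
    have e4 : ‖(1 / (2 * τ) : ℂ)‖ = ‖τ⁻¹‖ / 2 := by
      rw [norm_div, norm_mul, norm_inv]; simp; ring
    rw [e3, e4]
    have h5 : |w j| ^ 2 * ‖τ⁻¹‖ ^ 2 ≤ (1 + ‖w‖) ^ 2 * B ^ 2 :=
      mul_le_mul (pow_le_pow_left₀ (abs_nonneg _) (by linarith) 2)
        (pow_le_pow_left₀ hn0 hτ2.le 2) (by positivity) (by positivity)
    have h6 : ‖τ⁻¹‖ ≤ (1 + ‖w‖) ^ 2 * B ^ 2 := by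
      have : (1 : ℝ) ≤ (1 + ‖w‖) ^ 2 := by nlinarith
      nlinarith
    have : 0 ≤ |w j| ^ 2 * ‖τ⁻¹‖ ^ 2 := by positivity
    linarith
  rw [gaussD, gaussDD, norm_mul, norm_mul, norm_neg]
  constructor
  · calc _ ≤ (B ^ 2 * (1 + ‖w‖) ^ 2) * A := mul_le_mul e1 hg (norm_nonneg _) (by positivity)
      _ = _ := by ring
  · calc _ ≤ (B ^ 2 * (1 + ‖w‖) ^ 2) * A := mul_le_mul e2 hg (norm_nonneg _) (by positivity)
      _ = _ := by ring

lemma gauss_add_smul_single {τ : ℂ} (w : Fin N → ℝ) (j : Fin N) (r : ℝ) :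
    gauss τ (w + r • unitVec j) =
      gauss τ w * Complex.exp (-(2 * r * w j + r ^ 2 : ℂ) / (4 * τ)) := by
  have e : ∑ i, (w + r • unitVec j) i ^ 2 = ∑ i, w i ^ 2 + (2 * r * w j + r ^ 2) := by
    have : ∀ i, (w + r • unitVec j) i ^ 2 =
        w i ^ 2 + if i = j then 2 * r * w j + r ^ 2 else 0 := by
      intro i
      by_cases h : i = j
      · subst h; simp [unitVec]; ring
      · simp [h, unitVec]
    simp only [this, Finset.sum_add_distrib, Finset.sum_ite_eq', Finset.mem_univ, if_true]
  rw [gauss_eq, gauss_eq, e, mul_assoc (kernPre τ ^ N), ← Complex.exp_add]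
  congr 2
  push_cast
  ring

lemma hasDerivAt_gauss_zero {τ : ℂ} (w : Fin N → ℝ) (j : Fin N) :
    HasDerivAt (fun r : ℝ => gauss τ (w + r • unitVec j)) (gaussD τ j w) 0 := by
  simp_rw [gauss_add_smul_single]
  have h1 : HasDerivAt (fun z : ℂ => -(2 * z * w j + z ^ 2) / (4 * τ)) (-(w j / (2 * τ)))
      ((0 : ℝ) : ℂ) := by
    have h2 : HasDerivAt (fun z : ℂ => 2 * z * (w j : ℂ) + z ^ 2) (2 * (w j : ℂ)) ((0 : ℝ) : ℂ) := by
      have := (((hasDerivAt_id ((0 : ℝ) : ℂ)).const_mul 2).mul_const (w j : ℂ)).fun_add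
        (hasDerivAt_pow 2 ((0 : ℝ) : ℂ))
      refine this.congr_deriv ?_
      simp
    exact (h2.fun_neg.div_const (4 * τ)).congr_deriv (by ring)
  refine ((h1.cexp.const_mul (gauss τ w)).comp_ofReal).congr_deriv ?_
  simp [gaussD, mul_comm]

lemma hasDerivAt_gaussD_zero {τ : ℂ} (w : Fin N → ℝ) (j : Fin N) :
    HasDerivAt (fun r : ℝ => gaussD τ j (w + r • unitVec j)) (gaussDD τ j w) 0 := by
  have h1 : HasDerivAt (fun r : ℝ => -((((w + r • unitVec j) j : ℝ) : ℂ) / (2 * τ)))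
      (-(1 / (2 * τ))) 0 := by
    simp only [unitVec, Pi.add_apply, Pi.smul_apply, Pi.single_eq_same, smul_eq_mul, mul_one]
    have := ((hasDerivAt_id (0 : ℝ)).const_add (w j)).ofReal_comp.div_const (2 * τ)
    simpa using! this.fun_neg
  refine (h1.fun_mul (hasDerivAt_gauss_zero w j)).congr_deriv ?_
  simp [gaussD, gaussDD]
  ring

/-- The heat equation `∂_τ = ∂_u²` in complex time: the factor is the one in `gaussDD`. -/
lemma hasDerivAt_kern {τ : ℂ} (hτ : 0 ≤ τ.re) (h0 : τ ≠ 0) (u : ℝ) :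
    HasDerivAt (fun z => kern z u) (((u : ℂ) ^ 2 / (4 * τ ^ 2) - 1 / (2 * τ)) * kern τ u) τ := by
  have hpi : (Real.pi : ℂ) ≠ 0 := by exact_mod_cast Real.pi_ne_zero
  have h1 : HasDerivAt (fun z : ℂ => (Real.pi : ℂ) / z) (-(Real.pi / τ ^ 2)) τ := by
    refine ((hasDerivAt_const τ (Real.pi : ℂ)).fun_div (hasDerivAt_id τ) h0).congr_deriv ?_
    simp; ring
  have h2 := h1.cpow_const (c := (1 / 2 : ℂ)) (pi_div_mem_slitPlane hτ h0)
  have h3 : HasDerivAt (fun z : ℂ => -(u : ℂ) ^ 2 / (4 * z)) ((u : ℂ) ^ 2 / (4 * τ ^ 2)) τ := by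
    refine ((hasDerivAt_const τ (-(u : ℂ) ^ 2)).fun_div ((hasDerivAt_id τ).const_mul 4)
      (by simpa using h0)).congr_deriv ?_
    simp; field_simp
  refine ((h2.const_mul (1 / (2 * (Real.pi : ℂ)))).fun_mul h3.cexp).congr_deriv ?_
  rw [Complex.cpow_sub _ _ (div_ne_zero hpi h0), Complex.cpow_one, kern]
  field_simp
  ring

lemma hasDerivAt_gauss_time (w : Fin N → ℝ) {t : ℝ} (ht : t ≠ 0) :
    HasDerivAt (fun t : ℝ => gauss (Complex.I * t) w)
      (Complex.I * ∑ j, gaussDD (Complex.I * t) j w) t := by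
  have h0 : Complex.I * (t : ℂ) ≠ 0 := by simp [ht]
  have hz : HasDerivAt (fun t : ℝ => Complex.I * (t : ℂ)) Complex.I t := by
    simpa using (Complex.ofRealCLM.hasDerivAt (x := t)).const_mul Complex.I
  have h := HasDerivAt.fun_finsetProd (u := Finset.univ) fun i _ =>
    (hasDerivAt_kern (τ := Complex.I * (t : ℂ)) (by simp) h0 (w i)).comp t hz
  refine h.congr_deriv ?_
  rw [Finset.mul_sum]
  refine Finset.sum_congr rfl fun j _ => ?_
  rw [gaussDD, gauss, ← Finset.prod_erase_mul _ _ (Finset.mem_univ j)]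
  simp only [smul_eq_mul, Function.comp_apply]
  ring

section Avg

variable {c : ℝ} (hc : 0 < c) (σ : SignedPerm N)

/-- The dominating function for every limit and derivative below: quadratic growth of `G` costs two
powers of `delaySize`, uniformly for `d` in a ball. -/
lemma norm_comp_sub_shift_le {G : (Fin N → ℝ) → ℂ} {C : ℝ} (hC : 0 ≤ C)
    (hG : ∀ w, ‖G w‖ ≤ C * (1 + ‖w‖) ^ 2) {d : Fin N → ℝ} {R : ℝ} (hd : ‖d‖ ≤ R)
    (s : σ.inversions → ℝ) :
    ‖G (d - σ.shift s)‖ ≤ C * (1 + R + 2 * σ.inversions.card) ^ 2 * delaySize s ^ 2 := by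
  refine (hG _).trans ?_
  rw [mul_assoc, ← mul_pow]
  refine mul_le_mul_of_nonneg_left (pow_le_pow_left₀ (by positivity) ?_ 2) hC
  refine (σ.one_add_norm_sub_shift_le s d).trans ?_
  exact mul_le_mul_of_nonneg_right (by linarith) (zero_le_one.trans (one_le_delaySize s))

include hc

lemma integrable_delayAvg {G : (Fin N → ℝ) → ℂ} (hG : Continuous G) {C : ℝ} (hC : 0 ≤ C)
    (hb : ∀ w, ‖G w‖ ≤ C * (1 + ‖w‖) ^ 2) (d : Fin N → ℝ) :
    Integrable (fun s => delayWeights c s * G (d - σ.shift s)) (delayMeasures σ.inversions) :=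
  integrable_delayWeights_mul hc
    (hG.comp (continuous_const.sub σ.continuous_shift)).aestronglyMeasurable _ 2
    (norm_comp_sub_shift_le σ hC hb le_rfl)

lemma tendsto_delayAvg {ι : Type*} {l : Filter ι} [l.IsCountablyGenerated]
    {G : ι → (Fin N → ℝ) → ℂ} {G₀ : (Fin N → ℝ) → ℂ} (hG : ∀ n, Continuous (G n))
    {C : ℝ} (hC : 0 ≤ C) (hb : ∀ᶠ n in l, ∀ w, ‖G n w‖ ≤ C * (1 + ‖w‖) ^ 2)
    (hlim : ∀ w, Tendsto (fun n => G n w) l (𝓝 (G₀ w))) (d : Fin N → ℝ) :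
    Tendsto (fun n => delayAvg c σ (G n) d) l (𝓝 (delayAvg c σ G₀ d)) := by
  refine tendsto_integral_filter_of_dominated_convergence
    (fun s => C * (1 + ‖d‖ + 2 * σ.inversions.card) ^ 2 * (delaySize s ^ 2 * ‖delayWeights c s‖))
    (Eventually.of_forall fun n => ?_) ?_ ((integrable_delaySize_pow hc 2).const_mul _)
    (ae_of_all _ fun s => (hlim _).const_mul _)
  · exact (measurable_delayWeights c).aestronglyMeasurable.mul
      ((hG n).comp (continuous_const.sub σ.continuous_shift)).aestronglyMeasurable
  · filter_upwards [hb] with n hn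
    refine ae_of_all _ fun s => ?_
    rw [norm_mul, mul_comm, ← mul_assoc]
    exact mul_le_mul_of_nonneg_right (norm_comp_sub_shift_le σ hC hn le_rfl s) (norm_nonneg _)

lemma hasDerivAt_delayAvg {G G' : (Fin N → ℝ) → ℂ} (hG : Continuous G) (hG' : Continuous G')
    {C : ℝ} (hC : 0 ≤ C) (hb : ∀ w, ‖G w‖ ≤ C * (1 + ‖w‖) ^ 2)
    (hb' : ∀ w, ‖G' w‖ ≤ C * (1 + ‖w‖) ^ 2) (j : Fin N)
    (hd : ∀ w, HasDerivAt (fun r : ℝ => G (w + r • unitVec j)) (G' w) 0) (d : Fin N → ℝ) :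
    HasDerivAt (fun r : ℝ => delayAvg c σ G (d + r • unitVec j)) (delayAvg c σ G' d) 0 := by
  -- A derivative at `0` from every base point gives the derivative at every `r` along the line.
  have hderiv : ∀ (w : Fin N → ℝ) (r : ℝ),
      HasDerivAt (fun r : ℝ => G (w + r • unitVec j)) (G' (w + r • unitVec j)) r := by
    intro w r
    have h := hd (w + r • unitVec j)
    rw [show (0 : ℝ) = r - r by ring] at h
    have h2 := h.comp_sub_const r r
    refine h2.congr_of_eventuallyEq (Eventually.of_forall fun q => ?_)
    simp only
    congr 1
    module
  have hsub : ∀ (r : ℝ) (s : σ.inversions → ℝ), d + r • unitVec j - σ.shift s =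
      d - σ.shift s + r • unitVec j := fun r s => by abel
  have hmeas : ∀ {H : (Fin N → ℝ) → ℂ}, Continuous H → ∀ r : ℝ, AEStronglyMeasurable
      (fun s => delayWeights c s * H (d + r • unitVec j - σ.shift s))
      (delayMeasures σ.inversions) := fun hH r =>
    (measurable_delayWeights c).aestronglyMeasurable.mul
      (hH.comp (continuous_const.sub σ.continuous_shift)).aestronglyMeasurable
  have key := hasDerivAt_integral_of_dominated_loc_of_deriv_le (𝕜 := ℝ)
    (μ := delayMeasures σ.inversions) (x₀ := (0 : ℝ)) (s := Metric.ball 0 1)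
    (F := fun r s => delayWeights c s * G (d + r • unitVec j - σ.shift s))
    (F' := fun r s => delayWeights c s * G' (d + r • unitVec j - σ.shift s))
    -- For `|r| < 1` the point `d + r • unitVec j` has norm at most `‖d‖ + 1`.
    (bound := fun s => C * (1 + (‖d‖ + 1) + 2 * σ.inversions.card) ^ 2 *
      (delaySize s ^ 2 * ‖delayWeights c s‖))
    (Metric.ball_mem_nhds 0 one_pos) (Eventually.of_forall fun r => hmeas hG r)
    (integrable_delayAvg hc σ hG hC hb _) (hmeas hG' 0) (ae_of_all _ fun s r hr => ?_)
    ((integrable_delaySize_pow hc 2).const_mul _) (ae_of_all _ fun s r _ => ?_)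
  · simpa [delayAvg] using key.2
  · rw [norm_mul, mul_comm, ← mul_assoc]
    refine mul_le_mul_of_nonneg_right (norm_comp_sub_shift_le σ hC hb' ?_ s) (norm_nonneg _)
    refine (norm_add_le _ _).trans (add_le_add le_rfl ?_)
    rw [norm_smul, unitVec, Pi.norm_single, norm_one, mul_one]
    simpa using (mem_ball_zero_iff.1 hr).le
  · simp only [hsub]
    exact (hderiv _ r).const_mul _

lemma hasDerivAt_delayAvg_time (d : Fin N → ℝ) {t : ℝ} (ht : t ≠ 0) :
    HasDerivAt (fun t : ℝ => delayAvg c σ (gauss (Complex.I * t)) d)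
      (Complex.I * ∑ j, delayAvg c σ (gaussDD (Complex.I * t) j) d) t := by
  have h0 : Complex.I * (t : ℂ) ≠ 0 := by simp [ht]
  obtain ⟨C, hC, hev⟩ := exists_gauss_bounds N (τ₀ := Complex.I * t) (by simp) h0
  have hcont : Continuous fun t : ℝ => Complex.I * (t : ℂ) := by fun_prop
  have hev' := ((hcont.tendsto t).eventually hev).and (isOpen_ne.eventually_mem ht)
  have hmeas : ∀ {H : (Fin N → ℝ) → ℂ}, Continuous H → AEStronglyMeasurable
      (fun s => delayWeights c s * H (d - σ.shift s)) (delayMeasures σ.inversions) := fun hH =>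
    (measurable_delayWeights c).aestronglyMeasurable.mul
      (hH.comp (continuous_const.sub σ.continuous_shift)).aestronglyMeasurable
  have hb : ∀ {τ : ℂ}, (∀ w : Fin N → ℝ, ‖gauss τ w‖ ≤ C ∧ ∀ j,
      ‖gaussD τ j w‖ ≤ C * (1 + ‖w‖) ^ 2 ∧ ‖gaussDD τ j w‖ ≤ C * (1 + ‖w‖) ^ 2) →
      ∀ w : Fin N → ℝ, ‖Complex.I * ∑ j, gaussDD τ j w‖ ≤ (N * C) * (1 + ‖w‖) ^ 2 := by
    intro τ h w
    rw [norm_mul, Complex.norm_I, one_mul]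
    refine (norm_sum_le _ _).trans ((Finset.sum_le_sum fun j _ => ((h w).2 j).2).trans ?_)
    simp [mul_assoc]
  have hself := (hev.self_of_nhds (by simp))
  have key := hasDerivAt_integral_of_dominated_loc_of_deriv_le (𝕜 := ℝ)
    (μ := delayMeasures σ.inversions) (x₀ := t) hev'
    (F := fun t s => delayWeights c s * gauss (Complex.I * t) (d - σ.shift s))
    (F' := fun t s => delayWeights c s *
      (Complex.I * ∑ j, gaussDD (Complex.I * t) j (d - σ.shift s)))
    (bound := fun s => (N * C) * (1 + ‖d‖ + 2 * σ.inversions.card) ^ 2 *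
      (delaySize s ^ 2 * ‖delayWeights c s‖))
    (Eventually.of_forall fun r => hmeas (continuous_gauss _))
    (integrable_delayWeights_mul hc
      ((continuous_gauss _).comp (continuous_const.sub σ.continuous_shift)).aestronglyMeasurable
      C 0 fun s => by simpa using (hself _).1)
    (hmeas (H := fun w => Complex.I * ∑ j, gaussDD (Complex.I * t) j w)
      (continuous_const.mul (continuous_finsetSum _ fun j _ => continuous_gaussDD _ j)))
    (ae_of_all _ fun s r hr => ?_)
    ((integrable_delaySize_pow hc 2).const_mul _) (ae_of_all _ fun s r hr => ?_)
  · refine key.2.congr_deriv ?_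
    simp only [delayAvg]
    rw [← integral_finsetSum, ← integral_const_mul]
    · refine integral_congr_ae (ae_of_all _ fun s => ?_)
      simp only [← Finset.mul_sum]
      ring
    · exact fun j _ => integrable_delayAvg hc σ (continuous_gaussDD _ j) hC
        (fun w => ((hself w).2 j).2) d
  · rw [norm_mul, mul_comm, ← mul_assoc]
    exact mul_le_mul_of_nonneg_right (norm_comp_sub_shift_le σ (by positivity)
      (hb (hr.1 (by simp))) le_rfl s) (norm_nonneg _)
  · exact (hasDerivAt_gauss_time _ hr.2).const_mul _

lemma hasDerivAt_delayAvg_gauss (j : Fin N) (d : Fin N → ℝ) {t : ℝ} (ht : t ≠ 0) :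
    HasDerivAt (fun r : ℝ => delayAvg c σ (gauss (Complex.I * t)) (d + r • unitVec j))
      (delayAvg c σ (gaussD (Complex.I * t) j) d) 0 := by
  have h0 : Complex.I * (t : ℂ) ≠ 0 := by simp [ht]
  obtain ⟨C, hC, hev⟩ := exists_gauss_bounds N (τ₀ := Complex.I * t) (by simp) h0
  have hself := hev.self_of_nhds (by simp)
  refine hasDerivAt_delayAvg hc σ (continuous_gauss _) (continuous_gaussD _ j) hC
    (fun w => (hself w).1.trans ?_) (fun w => ((hself w).2 j).1) j
    (fun w => hasDerivAt_gauss_zero w j) d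
  exact le_mul_of_one_le_right hC (one_le_pow₀ (by linarith [norm_nonneg w]))

lemma hasDerivAt_delayAvg_gaussD (j : Fin N) (d : Fin N → ℝ) {t : ℝ} (ht : t ≠ 0) :
    HasDerivAt (fun r : ℝ => delayAvg c σ (gaussD (Complex.I * t) j) (d + r • unitVec j))
      (delayAvg c σ (gaussDD (Complex.I * t) j) d) 0 := by
  have h0 : Complex.I * (t : ℂ) ≠ 0 := by simp [ht]
  obtain ⟨C, hC, hev⟩ := exists_gauss_bounds N (τ₀ := Complex.I * t) (by simp) h0
  have hself := hev.self_of_nhds (by simp)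
  exact hasDerivAt_delayAvg hc σ (continuous_gaussD _ j) (continuous_gaussDD _ j) hC
    (fun w => ((hself w).2 j).1) (fun w => ((hself w).2 j).2) j
    (fun w => hasDerivAt_gaussD_zero w j) d

end Avg

lemma partialDeriv_eq_of_hasDerivAt {f : (Fin N → ℝ) → ℂ} {x : Fin N → ℝ} {j : Fin N} {f' : ℂ}
    (hf : DifferentiableAt ℝ f x)
    (h : HasDerivAt (fun r : ℝ => f (x + r • unitVec j)) f' 0) : partialDeriv j f x = f' := by
  rw [partialDeriv, ← hf.lineDeriv_eq_fderiv]
  exact h.deriv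

lemma contDiff_wave {c : ℝ} (hc : 0 < c) (y : Fin N → ℝ) {t : ℝ} (ht : t ≠ 0) :
    ContDiff ℝ ∞ fun x => wave c y x t :=
  ContDiff.sum fun σ _ => contDiff_const.mul (contDiff_delayAvg_gauss hc σ _ ht)

lemma contDiff_partialDeriv {f : (Fin N → ℝ) → ℂ} (hf : ContDiff ℝ ∞ f) (j : Fin N) :
    ContDiff ℝ ∞ (partialDeriv j f) := by
  have h := hf.fderiv_right (m := ∞) (by simp)
  exact h.clm_apply contDiff_const

lemma partialDeriv_wave {c : ℝ} (hc : 0 < c) (y : Fin N → ℝ) {t : ℝ} (ht : t ≠ 0) (j : Fin N) :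
    partialDeriv j (fun x => wave c y x t) = fun x => ∑ σ : SignedPerm N,
      σ.sgn * delayAvg c σ (gaussD (Complex.I * t) j) (x - σ.momentum y) := by
  funext x
  refine partialDeriv_eq_of_hasDerivAt ((contDiff_wave hc y ht).differentiable (by simp) x) ?_
  refine HasDerivAt.fun_sum fun σ _ => ?_
  have h := (hasDerivAt_delayAvg_gauss hc σ j (x - σ.momentum y) ht).const_mul σ.sgn
  simpa only [add_sub_right_comm] using h

lemma partialDeriv_partialDeriv_wave {c : ℝ} (hc : 0 < c) (y x : Fin N → ℝ) {t : ℝ} (ht : t ≠ 0)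
    (j : Fin N) :
    partialDeriv j (partialDeriv j fun x => wave c y x t) x = ∑ σ : SignedPerm N,
      σ.sgn * delayAvg c σ (gaussDD (Complex.I * t) j) (x - σ.momentum y) := by
  refine partialDeriv_eq_of_hasDerivAt
    ((contDiff_partialDeriv (contDiff_wave hc y ht) j).differentiable (by simp) x) ?_
  rw [partialDeriv_wave hc y ht]
  refine HasDerivAt.fun_sum fun σ _ => ?_
  have h := (hasDerivAt_delayAvg_gaussD hc σ j (x - σ.momentum y) ht).const_mul σ.sgn
  simpa only [add_sub_right_comm] using h

theorem schrodinger_wave {c : ℝ} (hc : 0 < c) (y x : Fin N → ℝ) {t : ℝ} (ht : t ≠ 0) :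
    -∑ j, partialDeriv j (partialDeriv j fun z => wave c y z t) x =
      Complex.I * deriv (wave c y x) t := by
  have h : HasDerivAt (wave c y x) (∑ σ : SignedPerm N, σ.sgn *
      (Complex.I * ∑ j, delayAvg c σ (gaussDD (Complex.I * t) j) (x - σ.momentum y))) t :=
    HasDerivAt.fun_sum fun σ _ => (hasDerivAt_delayAvg_time hc σ _ ht).const_mul σ.sgn
  rw [h.deriv]
  simp_rw [partialDeriv_partialDeriv_wave hc y x ht]
  rw [Finset.sum_comm, Finset.mul_sum, ← Finset.sum_neg_distrib]
  refine Finset.sum_congr rfl fun σ _ => ?_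
  rw [← Finset.mul_sum]
  linear_combination (-(σ.sgn * ∑ j, delayAvg c σ (gaussDD (Complex.I * t) j)
    (x - σ.momentum y))) * Complex.I_sq

/-! ### Bethe relations between amplitudes -/

section Amplitude

lemma add_I_mul_ne_zero {c : ℝ} (hc : 0 < c) (κ : ℝ) : (c : ℂ) + Complex.I * κ ≠ 0 := by
  intro h
  have := congrArg Complex.re h
  simp at this
  exact hc.ne' this

lemma scattering_mul {c : ℝ} (hc : 0 < c) (κ : ℝ) :
    scattering c κ * (Complex.I * κ + c) = Complex.I * κ - c := by
  have := add_I_mul_ne_zero hc κ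
  rw [scattering]
  field_simp
  ring

lemma norm_scattering_le (c κ : ℝ) : ‖scattering c κ‖ ≤ 1 := by
  rw [scattering, norm_neg, norm_div]
  have : ‖(c : ℂ) - Complex.I * κ‖ = ‖(c : ℂ) + Complex.I * κ‖ := by
    rw [← Complex.norm_conj]
    simp [sub_eq_add_neg]
  rw [this]
  exact div_self_le_one _

lemma continuous_scattering {c : ℝ} (hc : 0 < c) : Continuous (scattering c) := by
  unfold scattering
  exact (Continuous.div (by fun_prop) (by fun_prop) (add_I_mul_ne_zero hc)).neg

lemma norm_twoBodyProd_le (c : ℝ) (σ : SignedPerm N) (k : Fin N → ℝ) :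
    ‖twoBodyProd c σ k‖ ≤ 1 := by
  rw [twoBodyProd, norm_prod]
  exact Finset.prod_le_one (fun _ _ => norm_nonneg _) fun _ _ => norm_scattering_le _ _

lemma continuous_twoBodyProd {c : ℝ} (hc : 0 < c) (σ : SignedPerm N) :
    Continuous (twoBodyProd c σ) := by
  have := continuous_scattering hc
  have := σ.continuous_momentum
  unfold twoBodyProd
  fun_prop

/-- The factor of the amplitude at a possible inversion. -/
def inversionFactor (c : ℝ) (σ : SignedPerm N) (k : Fin N → ℝ) (p : ℤˣ × Fin N × Fin N) : ℂ :=
  if p.2.1 < p.2.2 ∧ σ.entry p.2.2 < (p.1 : ℤ) * σ.entry p.2.1 then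
    scattering c (((p.1 : ℤ) : ℝ) * σ.momentum k p.2.1 - σ.momentum k p.2.2) else 1

lemma twoBodyProd_eq_prod (c : ℝ) (σ : SignedPerm N) (k : Fin N → ℝ) :
    twoBodyProd c σ k = ∏ p, inversionFactor c σ k p := by
  rw [twoBodyProd, SignedPerm.inversions, Finset.prod_filter]
  rfl

namespace SignedPerm

lemma entry_neg_iff (σ : SignedPerm N) (i : Fin N) : σ.entry i < 0 ↔ σ.2 i = -1 := by
  unfold entry
  rcases Int.units_eq_one_or (σ.2 i) with h | h <;> rw [h] <;> simp <;> omega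

lemma abs_entry (σ : SignedPerm N) (i : Fin N) : |σ.entry i| = (σ.1 i : ℕ) + 1 := by
  unfold entry
  rw [abs_mul, Int.isUnit_iff_abs_eq.1 (σ.2 i).isUnit, one_mul, abs_of_nonneg (by positivity)]

lemma entry_injective (σ : SignedPerm N) : Function.Injective σ.entry := by
  intro i j h
  have h2 := congrArg abs h
  rw [abs_entry, abs_entry] at h2
  exact σ.1.injective (Fin.ext (by exact_mod_cast add_right_cancel h2))

lemma sgn_eq_prod (σ : SignedPerm N) : σ.sgn = ∏ i, ((σ.2 i : ℤ) : ℂ) := by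
  have : ∀ i, ((σ.2 i : ℤ) : ℂ) = if σ.entry i < 0 then -1 else 1 := by
    intro i
    simp only [entry_neg_iff]
    rcases Int.units_eq_one_or (σ.2 i) with h | h <;> simp [h]
  simp only [this, Finset.prod_ite, Finset.prod_const, one_pow, mul_one, sgn]

/-- Interchange of the values at `i` and `j`. -/
def swapAt (i j : Fin N) (σ : SignedPerm N) : SignedPerm N :=
  (σ.1 * Equiv.swap i j, fun l => σ.2 (Equiv.swap i j l))

lemma swapAt_involutive (i j : Fin N) : Function.Involutive (swapAt i j) := by
  intro σ
  ext <;> simp [swapAt, mul_assoc]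

lemma entry_swapAt (i j : Fin N) (σ : SignedPerm N) (l : Fin N) :
    (swapAt i j σ).entry l = σ.entry (Equiv.swap i j l) := rfl

lemma momentum_swapAt (i j : Fin N) (σ : SignedPerm N) (k : Fin N → ℝ) (l : Fin N) :
    (swapAt i j σ).momentum k l = σ.momentum k (Equiv.swap i j l) := rfl

lemma sgn_swapAt (i j : Fin N) (σ : SignedPerm N) : (swapAt i j σ).sgn = σ.sgn := by
  rw [sgn_eq_prod, sgn_eq_prod]
  exact Equiv.prod_comp (Equiv.swap i j) fun l => ((σ.2 l : ℤ) : ℂ)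

/-- Change of the sign of the value at `i`. -/
def flipAt (i : Fin N) (σ : SignedPerm N) : SignedPerm N :=
  (σ.1, Function.update σ.2 i (-σ.2 i))

lemma flipAt_involutive (i : Fin N) : Function.Involutive (flipAt i) := by
  intro σ
  ext <;> simp [flipAt]

lemma entry_flipAt (i : Fin N) (σ : SignedPerm N) (l : Fin N) :
    (flipAt i σ).entry l = if l = i then -σ.entry l else σ.entry l := by
  unfold entry flipAt
  by_cases h : l = i
  · subst h; simp
  · simp [h]

lemma momentum_flipAt (i : Fin N) (σ : SignedPerm N) (k : Fin N → ℝ) (l : Fin N) :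
    (flipAt i σ).momentum k l = if l = i then -σ.momentum k l else σ.momentum k l := by
  unfold momentum flipAt
  by_cases h : l = i
  · subst h; simp
  · simp [h]

lemma sgn_flipAt (i : Fin N) (σ : SignedPerm N) : (flipAt i σ).sgn = -σ.sgn := by
  rw [sgn_eq_prod, sgn_eq_prod, ← Finset.mul_prod_erase _ _ (Finset.mem_univ i),
    ← Finset.mul_prod_erase (Finset.univ) (fun l => ((σ.2 l : ℤ) : ℂ)) (Finset.mem_univ i),
    ← neg_mul]
  congr 1
  · simp [flipAt]
  · refine Finset.prod_congr rfl fun l hl => ?_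
    simp [flipAt, Finset.ne_of_mem_erase hl]

end SignedPerm

/-- The first position is never the second index of an inversion. As a first index it occurs with
both signs `η`, so the change of sign is undone by `η ↦ -η`. -/
lemma twoBodyProd_flipAt (c : ℝ) (i : Fin N) (hi : (i : ℕ) = 0) (σ : SignedPerm N)
    (k : Fin N → ℝ) : twoBodyProd c (σ.flipAt i) k = twoBodyProd c σ k := by
  rw [twoBodyProd_eq_prod, twoBodyProd_eq_prod]
  let φ : ℤˣ × Fin N × Fin N → ℤˣ × Fin N × Fin N := fun p =>
    (if p.2.1 = i then -p.1 else p.1, p.2)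
  have hφ : Function.Involutive φ := by
    rintro ⟨η, a, b⟩
    by_cases h : a = i <;> simp [φ, h]
  refine Fintype.prod_bijective φ hφ.bijective _ _ ?_
  rintro ⟨η, a, b⟩
  simp only [inversionFactor, φ, SignedPerm.entry_flipAt, SignedPerm.momentum_flipAt]
  by_cases hab : a < b
  · have hb : b ≠ i := by rintro rfl; rw [Fin.lt_def] at hab; omega
    by_cases ha : a = i <;> simp [ha, hb]
  · simp [hab]

lemma swap_lt_swap_iff {i j : Fin N} (hij : (j : ℕ) = i + 1) {a b : Fin N}
    (h1 : ¬ (a = i ∧ b = j)) (h2 : ¬ (a = j ∧ b = i)) :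
    Equiv.swap i j a < Equiv.swap i j b ↔ a < b := by
  rw [Fin.lt_def, Fin.lt_def]
  simp only [Equiv.swap_apply_def, Fin.ext_iff] at h1 h2 ⊢
  split_ifs <;> omega

/-- The product of the factors other than the one at the inversion `(σ(i), σ(j))`. -/
def twoBodyRest (c : ℝ) (i j : Fin N) (σ : SignedPerm N) (k : Fin N → ℝ) : ℂ :=
  ∏ p, if p = (1, i, j) then 1 else inversionFactor c σ k p

lemma twoBodyProd_eq_mul_rest (c : ℝ) (i j : Fin N) (σ : SignedPerm N) (k : Fin N → ℝ) :
    twoBodyProd c σ k = inversionFactor c σ k (1, i, j) * twoBodyRest c i j σ k := by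
  rw [twoBodyProd_eq_prod, twoBodyRest, ← Finset.mul_prod_erase _ _ (Finset.mem_univ (1, i, j)),
    ← Finset.mul_prod_erase Finset.univ (fun p => if p = (1, i, j) then 1 else _)
      (Finset.mem_univ (1, i, j)), if_pos rfl, one_mul]
  congr 1
  exact Finset.prod_congr rfl fun p hp => (if_neg (Finset.ne_of_mem_erase hp)).symm

/-- An adjacent transposition keeps the order of every other pair of positions, so the factors there
are permuted. The remaining factor `(-1, i, j)` is fixed: its condition `σ(i) + σ(j) < 0` and its
argument `-(k_{σ(i)} + k_{σ(j)})` are symmetric. -/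
lemma twoBodyRest_swapAt (c : ℝ) {i j : Fin N} (hij : (j : ℕ) = i + 1) (σ : SignedPerm N)
    (k : Fin N → ℝ) : twoBodyRest c i j (σ.swapAt i j) k = twoBodyRest c i j σ k := by
  have hlt : i < j := by rw [Fin.lt_def]; omega
  let φ : ℤˣ × Fin N × Fin N → ℤˣ × Fin N × Fin N := fun p =>
    if (p.2.1 = i ∧ p.2.2 = j) ∨ (p.2.1 = j ∧ p.2.2 = i) then p else
      (p.1, Equiv.swap i j p.2.1, Equiv.swap i j p.2.2)
  have hsw : ∀ a b : Fin N, (Equiv.swap i j a = i ∧ Equiv.swap i j b = j ∨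
      Equiv.swap i j a = j ∧ Equiv.swap i j b = i) ↔ (a = i ∧ b = j ∨ a = j ∧ b = i) := by
    intro a b
    simp only [Equiv.swap_apply_eq_iff, Equiv.swap_apply_left, Equiv.swap_apply_right]
    exact or_comm
  have hφ : Function.Involutive φ := by
    rintro ⟨η, a, b⟩
    by_cases h : (a = i ∧ b = j) ∨ (a = j ∧ b = i)
    · simp only [φ, h, if_true]
    · simp only [φ, h, if_false, hsw, Equiv.swap_apply_self]
  refine Fintype.prod_bijective φ hφ.bijective _ _ ?_
  rintro ⟨η, a, b⟩
  by_cases h1 : a = i ∧ b = j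
  · obtain ⟨rfl, rfl⟩ := h1
    simp only [φ, true_or, and_true, if_true]
    rcases Int.units_eq_one_or η with rfl | rfl
    · simp
    · simp only [inversionFactor, SignedPerm.entry_swapAt, SignedPerm.momentum_swapAt,
        Equiv.swap_apply_left, Equiv.swap_apply_right]
      have e1 : (σ.entry a < ((-1 : ℤˣ) : ℤ) * σ.entry b) ↔
          (σ.entry b < ((-1 : ℤˣ) : ℤ) * σ.entry a) := by
        simp; omega
      refine if_congr Iff.rfl rfl (if_congr (and_congr Iff.rfl e1) (congrArg _ ?_) rfl)
      simp only [Units.val_neg, Units.val_one, Int.cast_neg, Int.cast_one]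
      ring
  · by_cases h2 : a = j ∧ b = i
    · obtain ⟨rfl, rfl⟩ := h2
      simp [φ, inversionFactor, hlt.not_gt, hlt.ne, hlt.ne']
    · have h : ¬ ((a = i ∧ b = j) ∨ (a = j ∧ b = i)) := by tauto
      have h' : ¬ (Equiv.swap i j a = i ∧ Equiv.swap i j b = j) := fun hh =>
        h ((hsw a b).1 (Or.inl hh))
      have e1 : ((η, a, b) : ℤˣ × Fin N × Fin N) ≠ (1, i, j) := by
        simp only [ne_eq, Prod.mk.injEq]; tauto
      have e2 : ((η, Equiv.swap i j a, Equiv.swap i j b) : ℤˣ × Fin N × Fin N) ≠ (1, i, j) := by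
        simp only [ne_eq, Prod.mk.injEq]; tauto
      simp only [φ, h, if_false, e1, e2]
      simp only [inversionFactor, SignedPerm.entry_swapAt, SignedPerm.momentum_swapAt,
        swap_lt_swap_iff hij h1 h2]
      exact if_congr Iff.rfl rfl rfl

/-- The two-body scattering relation between the amplitudes of `σ` and of `σ` with two neighbouring
values interchanged. -/
lemma twoBodyProd_swapAt_mul {c : ℝ} (hc : 0 < c) {i j : Fin N} (hij : (j : ℕ) = i + 1)
    (σ : SignedPerm N) (k : Fin N → ℝ) :
    twoBodyProd c (σ.swapAt i j) k *
        (Complex.I * (σ.momentum k i : ℂ) - Complex.I * (σ.momentum k j : ℂ) - c) =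
      -(twoBodyProd c σ k *
        (Complex.I * (σ.momentum k j : ℂ) - Complex.I * (σ.momentum k i : ℂ) - c)) := by
  have hlt : i < j := by rw [Fin.lt_def]; omega
  rw [twoBodyProd_eq_mul_rest c i j, twoBodyProd_eq_mul_rest c i j σ, twoBodyRest_swapAt c hij]
  simp only [inversionFactor, SignedPerm.entry_swapAt, SignedPerm.momentum_swapAt,
    Equiv.swap_apply_left, Equiv.swap_apply_right, hlt, true_and, Units.val_one, one_mul,
    Int.cast_one]
  -- Exactly one of `σ` and its interchange has the inversion `(1, i, j)`; its factor `S` supplies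
  -- the ratio.
  rcases lt_or_gt_of_ne (σ.entry_injective.ne hlt.ne) with h | h
  · rw [if_pos h, if_neg h.not_gt]
    have := scattering_mul hc (σ.momentum k j - σ.momentum k i)
    push_cast at this
    linear_combination (-twoBodyRest c i j σ k) * this
  · rw [if_pos h, if_neg h.not_gt]
    have := scattering_mul hc (σ.momentum k i - σ.momentum k j)
    push_cast at this
    linear_combination (-twoBodyRest c i j σ k) * this

end Amplitude

/-! ### Boundary conditions at regularized time -/

section Regularized

/-- The regularized plane wave. -/
def dampedWave (σ : SignedPerm N) (τ : ℂ) (y x k : Fin N → ℝ) : ℂ :=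
  Complex.exp (-τ * ((∑ j, k j ^ 2 : ℝ) : ℂ) +
    Complex.I * ((∑ i, σ.momentum k i * x i - ∑ j, k j * y j : ℝ) : ℂ))

lemma dampedWave_eq_prod (σ : SignedPerm N) (τ : ℂ) (y x k : Fin N → ℝ) :
    dampedWave σ τ y x k = ∏ i, Complex.exp (-τ * (k (σ.1 i) : ℂ) ^ 2) *
      Complex.exp (Complex.I * ((σ.momentum k i * (x i - σ.momentum y i) : ℝ) : ℂ)) := by
  rw [Finset.prod_mul_distrib, ← Complex.exp_sum, ← Complex.exp_sum, ← Complex.exp_add,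
    dampedWave, ← σ.sum_momentum_mul_momentum k y, ← Equiv.sum_comp σ.1 fun j => k j ^ 2,
    ← Finset.sum_sub_distrib, Complex.ofReal_sum, Complex.ofReal_sum, Finset.mul_sum,
    Finset.mul_sum]
  simp only [mul_sub, Complex.ofReal_pow]

lemma integrable_gauss_mul_exp {τ : ℂ} (hτ : 0 < τ.re) (u : ℝ) :
    Integrable fun κ : ℝ => Complex.exp (-τ * (κ : ℂ) ^ 2) * Complex.exp (Complex.I * κ * u) := by
  refine (integrable_cexp_neg_mul_sq hτ).mul_bdd (c := 1)
    (by fun_prop : Continuous fun κ : ℝ => Complex.exp (Complex.I * κ * u)).aestronglyMeasurable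
    (ae_of_all _ fun κ => ?_)
  rw [mul_assoc, ← Complex.ofReal_mul, mul_comm, Complex.norm_exp_ofReal_mul_I]

lemma integrable_mul_gauss_mul_exp {τ : ℂ} (hτ : 0 < τ.re) (u : ℝ) :
    Integrable fun κ : ℝ =>
      κ * Complex.exp (-τ * (κ : ℂ) ^ 2) * Complex.exp (Complex.I * κ * u) := by
  refine (integrable_mul_cexp_neg_mul_sq hτ).mul_bdd (c := 1)
    (by fun_prop : Continuous fun κ : ℝ => Complex.exp (Complex.I * κ * u)).aestronglyMeasurable
    (ae_of_all _ fun κ => ?_)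
  rw [mul_assoc, ← Complex.ofReal_mul, mul_comm, Complex.norm_exp_ofReal_mul_I]

/-- The integral of the derivative of `e^{-τκ²} e^{iκu}` vanishes, which expresses the first moment
by the zeroth. -/
lemma integral_mul_gauss_mul_exp {τ : ℂ} (hτ : 0 < τ.re) (u : ℝ) :
    ∫ κ : ℝ, κ * Complex.exp (-τ * (κ : ℂ) ^ 2) * Complex.exp (Complex.I * κ * u) =
      Complex.I * u / (2 * τ) * (2 * Real.pi * kern τ u) := by
  have h0 : τ ≠ 0 := by rintro rfl; simp at hτ
  have h1 := integrable_gauss_mul_exp hτ u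
  have h2 := integrable_mul_gauss_mul_exp hτ u
  have h := integral_eq_zero_of_hasDerivAt_of_integrable
    (f := fun κ : ℝ => Complex.exp (-τ * (κ : ℂ) ^ 2) * Complex.exp (Complex.I * κ * u))
    (f' := fun κ : ℝ => (-2 * τ) *
      (κ * Complex.exp (-τ * (κ : ℂ) ^ 2) * Complex.exp (Complex.I * κ * u)) + Complex.I * u *
      (Complex.exp (-τ * (κ : ℂ) ^ 2) * Complex.exp (Complex.I * κ * u)))
    (fun κ => by
      have h3 : HasDerivAt (fun z : ℂ => -τ * z ^ 2) (-τ * (2 * κ)) (κ : ℂ) := by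
        simpa using (hasDerivAt_pow 2 (κ : ℂ)).const_mul (-τ)
      have h4 : HasDerivAt (fun z : ℂ => Complex.I * z * u) (Complex.I * u) (κ : ℂ) := by
        simpa using ((hasDerivAt_id (κ : ℂ)).const_mul Complex.I).mul_const (u : ℂ)
      refine (h3.cexp.fun_mul h4.cexp).comp_ofReal.congr_deriv ?_
      ring) ((h2.const_mul _).add (h1.const_mul _)) h1
  rw [integral_add (h2.const_mul _) (h1.const_mul _), integral_const_mul, integral_const_mul,
    integral_gauss_mul_exp hτ] at h
  rw [div_mul_eq_mul_div, eq_div_iff (by simpa using h0)]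
  linear_combination -h

lemma prod_ite_mul (A : ℂ) (j : Fin N) (f : Fin N → ℂ) :
    ∏ i, (if i = j then A * f i else f i) = A * ∏ i, f i := by
  have h : ∀ i, (if i = j then A * f i else f i) = (if i = j then A else 1) * f i := fun i => by
    split_ifs <;> simp
  simp only [h, Finset.prod_mul_distrib, Finset.prod_ite_eq', Finset.mem_univ, if_true]

lemma integrable_dampedWave {σ : SignedPerm N} {τ : ℂ} (hτ : 0 < τ.re) (y x : Fin N → ℝ) :
    Integrable (dampedWave σ τ y x) := by
  have h := integrable_prod_comp_perm σ.1
    (f := fun i κ => Complex.exp (-τ * (κ : ℂ) ^ 2) * Complex.exp (Complex.I * κ *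
      ((((σ.2 i : ℤ) : ℝ) * (x i - σ.momentum y i) : ℝ) : ℂ)))
    fun i => integrable_gauss_mul_exp hτ _
  refine h.congr (ae_of_all _ fun k => ?_)
  rw [dampedWave_eq_prod]
  refine Finset.prod_congr rfl fun i _ => ?_
  unfold SignedPerm.momentum
  push_cast
  ring_nf

lemma integrable_momentum_mul_dampedWave {σ : SignedPerm N} {τ : ℂ} (hτ : 0 < τ.re)
    (y x : Fin N → ℝ) (j : Fin N) :
    Integrable fun k => Complex.I * (σ.momentum k j : ℂ) * dampedWave σ τ y x k := by
  have h := integrable_prod_comp_perm σ.1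
    (f := fun i κ => if i = j then Complex.I * ((σ.2 j : ℤ) : ℂ) *
      (κ * Complex.exp (-τ * (κ : ℂ) ^ 2) * Complex.exp (Complex.I * κ *
      ((((σ.2 i : ℤ) : ℝ) * (x i - σ.momentum y i) : ℝ) : ℂ))) else
      Complex.exp (-τ * (κ : ℂ) ^ 2) * Complex.exp (Complex.I * κ *
      ((((σ.2 i : ℤ) : ℝ) * (x i - σ.momentum y i) : ℝ) : ℂ)))
    fun i => by
      split_ifs
      · exact (integrable_mul_gauss_mul_exp hτ _).const_mul _
      · exact integrable_gauss_mul_exp hτ _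
  refine h.congr (ae_of_all _ fun k => ?_)
  simp only
  rw [dampedWave_eq_prod, ← prod_ite_mul _ j]
  refine Finset.prod_congr rfl fun i _ => ?_
  by_cases h : i = j
  · subst h
    rw [if_pos rfl, if_pos rfl]
    unfold SignedPerm.momentum
    push_cast
    ring_nf
  · rw [if_neg h, if_neg h]
    unfold SignedPerm.momentum
    push_cast
    ring_nf

/-- For `Re τ > 0` the delay representation can be undone: the momentum integral converges
absolutely, and cancellations between signed permutations can be seen pointwise in `k`. -/
lemma delayAvg_gauss_eq_integral {c : ℝ} (hc : 0 < c) (σ : SignedPerm N) {τ : ℂ}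
    (hτ : 0 < τ.re) (y x : Fin N → ℝ) :
    delayAvg c σ (gauss τ) (x - σ.momentum y) =
      ((2 * Real.pi : ℂ) ^ N)⁻¹ * ∫ k, twoBodyProd c σ k * dampedWave σ τ y x k := by
  simp only [dampedWave_eq_prod]
  rw [integral_twoBodyProd_mul hc σ (h := fun _ κ => Complex.exp (-τ * (κ : ℂ) ^ 2))
    (fun _ => integrable_cexp_neg_mul_sq hτ) fun i => x i - σ.momentum y i,
    delayAvg, ← integral_const_mul]
  refine integral_congr_ae (ae_of_all _ fun s => ?_)
  simp only [integral_gauss_mul_exp hτ, kern_units_mul, gauss, Finset.prod_mul_distrib,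
    Finset.prod_const, Finset.card_univ, Fintype.card_fin, Pi.sub_apply]
  have hpi : (2 * Real.pi : ℂ) ^ N ≠ 0 :=
    pow_ne_zero _ (mul_ne_zero two_ne_zero (by exact_mod_cast Real.pi_ne_zero))
  field_simp
  rw [mul_pow]
  ring

lemma delayAvg_gaussD_eq_integral {c : ℝ} (hc : 0 < c) (σ : SignedPerm N) {τ : ℂ}
    (hτ : 0 < τ.re) (y x : Fin N → ℝ) (j : Fin N) :
    delayAvg c σ (gaussD τ j) (x - σ.momentum y) =
      ((2 * Real.pi : ℂ) ^ N)⁻¹ * ∫ k, twoBodyProd c σ k *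
        (Complex.I * (σ.momentum k j : ℂ) * dampedWave σ τ y x k) := by
  -- The factor `i k_{σ(j)}` of the derivative is absorbed into the profile of the `j`-th
  -- coordinate.
  have e : ∀ k, Complex.I * (σ.momentum k j : ℂ) * dampedWave σ τ y x k =
      ∏ i, (if i = j then Complex.I * ((σ.2 j : ℤ) : ℂ) * ((k (σ.1 i) : ℂ) *
        Complex.exp (-τ * (k (σ.1 i) : ℂ) ^ 2)) else Complex.exp (-τ * (k (σ.1 i) : ℂ) ^ 2)) *
      Complex.exp (Complex.I * ((σ.momentum k i * (x i - σ.momentum y i) : ℝ) : ℂ)) := by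
    intro k
    rw [dampedWave_eq_prod, ← prod_ite_mul _ j]
    refine Finset.prod_congr rfl fun i _ => ?_
    by_cases h : i = j
    · subst h
      rw [if_pos rfl, if_pos rfl]
      unfold SignedPerm.momentum
      push_cast
      ring
    · rw [if_neg h, if_neg h]
  simp only [e]
  rw [integral_twoBodyProd_mul hc σ (h := fun i κ => if i = j then Complex.I * ((σ.2 j : ℤ) : ℂ) *
    ((κ : ℂ) * Complex.exp (-τ * (κ : ℂ) ^ 2)) else Complex.exp (-τ * (κ : ℂ) ^ 2))
    (fun i => by
      split_ifs
      · exact (integrable_mul_cexp_neg_mul_sq hτ).const_mul _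
      · exact integrable_cexp_neg_mul_sq hτ) fun i => x i - σ.momentum y i,
    delayAvg, ← integral_const_mul]
  refine integral_congr_ae (ae_of_all _ fun s => ?_)
  have h1 : ∀ i, ∫ κ : ℝ, (if i = j then Complex.I * ((σ.2 j : ℤ) : ℂ) *
      ((κ : ℂ) * Complex.exp (-τ * (κ : ℂ) ^ 2)) else Complex.exp (-τ * (κ : ℂ) ^ 2)) *
      Complex.exp (Complex.I * κ *
        ((((σ.2 i : ℤ) : ℝ) * (x i - σ.momentum y i - σ.shift s i) : ℝ) : ℂ)) =
      (if i = j then -(((x j - σ.momentum y j - σ.shift s j : ℝ) : ℂ) / (2 * τ)) else 1) *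
        (2 * Real.pi * kern τ (x i - σ.momentum y i - σ.shift s i)) := by
    intro i
    by_cases h : i = j
    · subst h
      simp only [if_true]
      simp only [mul_assoc (Complex.I * ((σ.2 i : ℤ) : ℂ))]
      rw [integral_const_mul, integral_mul_gauss_mul_exp hτ, kern_units_mul]
      have h2 := congrArg (fun r : ℝ => (r : ℂ)) (SignedPerm.units_mul_self (σ.2 i))
      push_cast at h2 ⊢
      linear_combination (Complex.I * Complex.I * ((x i - σ.momentum y i - σ.shift s i : ℂ) /
        (2 * τ)) * (2 * Real.pi * kern τ (x i - σ.momentum y i - σ.shift s i))) * h2 +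
        (((x i - σ.momentum y i - σ.shift s i : ℂ) /
        (2 * τ)) * (2 * Real.pi * kern τ (x i - σ.momentum y i - σ.shift s i))) * Complex.I_sq
    · simp only [h, if_false, one_mul]
      rw [integral_gauss_mul_exp hτ, kern_units_mul]
  simp only [h1]
  simp only [gaussD, gauss, Finset.prod_mul_distrib, Finset.prod_ite_eq', Finset.mem_univ, if_true,
    Finset.prod_const, Finset.card_univ, Fintype.card_fin, Pi.sub_apply]
  have hpi : (2 * Real.pi : ℂ) ^ N ≠ 0 :=
    pow_ne_zero _ (mul_ne_zero two_ne_zero (by exact_mod_cast Real.pi_ne_zero))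
  field_simp
  rw [mul_pow]
  ring

lemma dampedWave_swapAt {i j : Fin N} (σ : SignedPerm N) (τ : ℂ) (y : Fin N → ℝ)
    {z : Fin N → ℝ} (hz : z j = z i) (k : Fin N → ℝ) :
    dampedWave (σ.swapAt i j) τ y z k = dampedWave σ τ y z k := by
  have h : ∑ l, (σ.swapAt i j).momentum k l * z l = ∑ l, σ.momentum k l * z l := by
    rw [← Equiv.sum_comp (Equiv.swap i j) fun l => σ.momentum k l * z l]
    refine Finset.sum_congr rfl fun l _ => ?_
    rw [SignedPerm.momentum_swapAt]
    congr 1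
    rw [Equiv.swap_apply_def]
    split_ifs with h1 h2
    · rw [h1, hz]
    · rw [h2, hz]
    · rfl
  rw [dampedWave, dampedWave, h]

lemma dampedWave_flipAt {i : Fin N} (σ : SignedPerm N) (τ : ℂ) (y : Fin N → ℝ)
    {z : Fin N → ℝ} (hz : z i = 0) (k : Fin N → ℝ) :
    dampedWave (σ.flipAt i) τ y z k = dampedWave σ τ y z k := by
  have h : ∑ l, (σ.flipAt i).momentum k l * z l = ∑ l, σ.momentum k l * z l := by
    refine Finset.sum_congr rfl fun l _ => ?_
    rw [SignedPerm.momentum_flipAt]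
    split_ifs with h1
    · rw [h1, hz]; simp
    · rfl
  rw [dampedWave, dampedWave, h]

lemma sum_eq_zero_of_involutive {α : Type*} [Fintype α] {φ : α → α} (hφ : Function.Involutive φ)
    {T : α → ℂ} (hT : ∀ a, T (φ a) = -T a) : ∑ a, T a = 0 := by
  have h : ∑ a, T a = ∑ a, -T a := by
    refine (Fintype.sum_bijective φ hφ.bijective (fun a => -T a) T fun a => (hT a).symm).symm
  rw [Finset.sum_neg_distrib] at h
  exact self_eq_neg.1 h

/-- At `z_i = 0` the plane waves of `σ` and `σ.flipAt i` agree, and so do their two-body products,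
while the signs are opposite. -/
lemma sum_sgn_mul_delayAvg_eq_zero {c : ℝ} (hc : 0 < c) {τ : ℂ} (hτ : 0 < τ.re) (y : Fin N → ℝ)
    {i : Fin N} (hi : (i : ℕ) = 0) {z : Fin N → ℝ} (hz : z i = 0) :
    ∑ σ : SignedPerm N, σ.sgn * delayAvg c σ (gauss τ) (z - σ.momentum y) = 0 := by
  refine sum_eq_zero_of_involutive (SignedPerm.flipAt_involutive i) fun σ => ?_
  rw [delayAvg_gauss_eq_integral hc _ hτ, delayAvg_gauss_eq_integral hc _ hτ,
    SignedPerm.sgn_flipAt, neg_mul]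
  simp only [dampedWave_flipAt σ τ y hz, twoBodyProd_flipAt c i hi]

/-- On `z_j = z_i` the plane waves of `σ` and `σ.swapAt i j` agree. The boundary operator multiplies
each by `i k_{σ(j)} - i k_{σ(i)} - c`, and the scattering relation makes the two products opposite.
-/
lemma sum_sgn_mul_interaction_eq_zero {c : ℝ} (hc : 0 < c) {τ : ℂ} (hτ : 0 < τ.re)
    (y : Fin N → ℝ) {i j : Fin N} (hij : (j : ℕ) = i + 1) {z : Fin N → ℝ} (hz : z j = z i) :
    ∑ σ : SignedPerm N, σ.sgn * (delayAvg c σ (gaussD τ j) (z - σ.momentum y) -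
      delayAvg c σ (gaussD τ i) (z - σ.momentum y) -
        c * delayAvg c σ (gauss τ) (z - σ.momentum y)) = 0 := by
  have key : ∀ σ : SignedPerm N, delayAvg c σ (gaussD τ j) (z - σ.momentum y) -
      delayAvg c σ (gaussD τ i) (z - σ.momentum y) -
        c * delayAvg c σ (gauss τ) (z - σ.momentum y) = ((2 * Real.pi : ℂ) ^ N)⁻¹ *
      ∫ k, twoBodyProd c σ k * (Complex.I * (σ.momentum k j : ℂ) -
        Complex.I * (σ.momentum k i : ℂ) - c) * dampedWave σ τ y z k := by
    intro σ
    have hb : ∀ {f : (Fin N → ℝ) → ℂ}, Integrable f →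
        Integrable fun k => twoBodyProd c σ k * f k := fun hf =>
      hf.bdd_mul (continuous_twoBodyProd hc σ).aestronglyMeasurable
        (ae_of_all _ (norm_twoBodyProd_le c σ))
    have h1 := fun l => hb (integrable_momentum_mul_dampedWave (σ := σ) hτ y z l)
    have h2 := hb (integrable_dampedWave (σ := σ) hτ y z)
    have h3 : Integrable fun k =>
        twoBodyProd c σ k * (Complex.I * (σ.momentum k j : ℂ) * dampedWave σ τ y z k) -
          twoBodyProd c σ k * (Complex.I * (σ.momentum k i : ℂ) * dampedWave σ τ y z k) :=
      (h1 j).sub (h1 i)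
    rw [delayAvg_gaussD_eq_integral hc σ hτ, delayAvg_gaussD_eq_integral hc σ hτ,
      delayAvg_gauss_eq_integral hc σ hτ, mul_left_comm, ← mul_sub, ← mul_sub,
      ← integral_const_mul, ← integral_sub (h1 j) (h1 i),
      ← integral_sub h3 (h2.const_mul _)]
    congr 1
    refine integral_congr_ae (ae_of_all _ fun k => ?_)
    simp only
    ring
  refine sum_eq_zero_of_involutive (SignedPerm.swapAt_involutive i j) fun σ => ?_
  rw [key, key, SignedPerm.sgn_swapAt, ← mul_neg, ← mul_neg, ← integral_neg]
  congr 2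
  refine integral_congr_ae (ae_of_all _ fun k => ?_)
  simp only [SignedPerm.momentum_swapAt, Equiv.swap_apply_left, Equiv.swap_apply_right,
    dampedWave_swapAt σ τ y hz, twoBodyProd_swapAt_mul hc hij]
  ring

end Regularized

/-! ### Removal of the regularization -/

section Limit

variable {c : ℝ} (hc : 0 < c)

lemma continuousAt_gauss {τ : ℂ} (hτ : 0 ≤ τ.re) (h0 : τ ≠ 0) (w : Fin N → ℝ) :
    ContinuousAt (fun τ => gauss τ w) τ := by
  unfold gauss
  exact tendsto_finsetProd _ fun i _ => (hasDerivAt_kern hτ h0 (w i)).continuousAt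

include hc

lemma tendsto_delayAvg_gauss (σ : SignedPerm N) (d : Fin N → ℝ) {t : ℝ} (ht : t ≠ 0) :
    Tendsto (fun ε : ℝ => delayAvg c σ (gauss (ε + Complex.I * t)) d) (𝓝[>] 0)
      (𝓝 (delayAvg c σ (gauss (Complex.I * t)) d)) := by
  have h0 : Complex.I * (t : ℂ) ≠ 0 := by simp [ht]
  obtain ⟨C, hC, hev⟩ := exists_gauss_bounds N (τ₀ := Complex.I * t) (by simp) h0
  refine tendsto_delayAvg hc σ (fun _ => continuous_gauss _) hC ?_ (fun w => ?_) d
  · filter_upwards [(tendsto_add_mul_I t).eventually hev, self_mem_nhdsWithin] with ε h hε w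
    refine (h (by simpa using (le_of_lt hε)) w).1.trans ?_
    exact le_mul_of_one_le_right hC (one_le_pow₀ (by linarith [norm_nonneg w]))
  · exact (continuousAt_gauss (by simp) h0 w).tendsto.comp (tendsto_add_mul_I t)

lemma tendsto_delayAvg_gaussD (σ : SignedPerm N) (d : Fin N → ℝ) {t : ℝ} (ht : t ≠ 0)
    (j : Fin N) :
    Tendsto (fun ε : ℝ => delayAvg c σ (gaussD (ε + Complex.I * t) j) d) (𝓝[>] 0)
      (𝓝 (delayAvg c σ (gaussD (Complex.I * t) j) d)) := by
  have h0 : Complex.I * (t : ℂ) ≠ 0 := by simp [ht]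
  obtain ⟨C, hC, hev⟩ := exists_gauss_bounds N (τ₀ := Complex.I * t) (by simp) h0
  refine tendsto_delayAvg hc σ (fun _ => continuous_gaussD _ j) hC ?_ (fun w => ?_) d
  · filter_upwards [(tendsto_add_mul_I t).eventually hev, self_mem_nhdsWithin] with ε h hε w
    exact ((h (by simpa using (le_of_lt hε)) w).2 j).1
  · have h1 : ContinuousAt (fun τ => gaussD τ j w) (Complex.I * t) := by
      unfold gaussD
      refine ContinuousAt.mul (ContinuousAt.neg (ContinuousAt.div continuousAt_const
        (by fun_prop) (by simpa using ht))) (continuousAt_gauss (by simp) h0 w)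
    exact h1.tendsto.comp (tendsto_add_mul_I t)

theorem wave_eq_zero (y : Fin N → ℝ) {t : ℝ} (ht : t ≠ 0) {i : Fin N} (hi : (i : ℕ) = 0)
    {z : Fin N → ℝ} (hz : z i = 0) : wave c y z t = 0 := by
  have h := tendsto_finsetSum (Finset.univ : Finset (SignedPerm N)) fun σ _ =>
    (tendsto_delayAvg_gauss hc σ (z - σ.momentum y) ht).const_mul σ.sgn
  refine tendsto_nhds_unique h ?_
  refine tendsto_const_nhds.congr' ?_
  filter_upwards [self_mem_nhdsWithin] with ε hε
  exact (sum_sgn_mul_delayAvg_eq_zero hc (by simpa using hε) y hi hz).symm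

/-- Both sides are delay averages, continuous as `ε + it → it`, so the identity obtained for `ε > 0`
passes to real time. -/
theorem partialDeriv_wave_sub (y : Fin N → ℝ) {t : ℝ} (ht : t ≠ 0) {i j : Fin N}
    (hij : (j : ℕ) = i + 1) {z : Fin N → ℝ} (hz : z j = z i) :
    partialDeriv j (fun x => wave c y x t) z - partialDeriv i (fun x => wave c y x t) z =
      c * wave c y z t := by
  have h := tendsto_finsetSum (Finset.univ : Finset (SignedPerm N)) fun σ _ =>
    (((tendsto_delayAvg_gaussD hc σ (z - σ.momentum y) ht j).sub
      (tendsto_delayAvg_gaussD hc σ (z - σ.momentum y) ht i)).sub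
      ((tendsto_delayAvg_gauss hc σ (z - σ.momentum y) ht).const_mul (c : ℂ))).const_mul σ.sgn
  have h0 := tendsto_nhds_unique h (b := 0) (tendsto_const_nhds.congr' (by
    filter_upwards [self_mem_nhdsWithin] with ε hε
    exact (sum_sgn_mul_interaction_eq_zero hc (by simpa using hε) y hij hz).symm))
  rw [partialDeriv_wave hc y ht, partialDeriv_wave hc y ht, wave]
  simp only
  rw [Finset.mul_sum, ← Finset.sum_sub_distrib, ← sub_eq_zero, ← Finset.sum_sub_distrib, ← h0]
  exact Finset.sum_congr rfl fun σ _ => by ring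

end Limit

/-! ### The free propagator against test functions -/

section TestFunction

lemma gauss_eq_fourier {τ : ℂ} (hτ : 0 < τ.re) (v w : EuclideanSpace ℝ (Fin N)) :
    FourierTransform.fourier (fun ξ : EuclideanSpace ℝ (Fin N) =>
      Complex.exp (-(4 * Real.pi ^ 2 * τ) * (‖ξ‖ : ℂ) ^ 2 +
        2 * Real.pi * Complex.I * (inner ℝ v ξ : ℝ))) w =
      gauss τ (w.ofLp - v.ofLp) := by
  have hpi : (Real.pi : ℂ) ≠ 0 := by exact_mod_cast Real.pi_ne_zero
  have h0 : τ ≠ 0 := by rintro rfl; simp at hτ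
  have hre : 0 < (4 * Real.pi ^ 2 * τ).re := by
    have : (4 * Real.pi ^ 2 * τ : ℂ) = ((4 * Real.pi ^ 2 : ℝ) : ℂ) * τ := by push_cast; ring
    rw [this, Complex.re_ofReal_mul]
    have := Real.pi_pos
    positivity
  rw [fourier_gaussian_innerProductSpace' hre, gauss_eq]
  have hx : (Real.pi : ℂ) / τ ≠ 0 := div_ne_zero hpi h0
  congr 1
  · have hr : (0 : ℝ) < (1 / (2 * Real.pi)) ^ 2 := by have := Real.pi_pos; positivity
    -- A positive multiple of `π / τ`: the principal logarithm splits off the positive factor, so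
    -- both square roots use the same branch.
    have e : (Real.pi : ℂ) / (4 * Real.pi ^ 2 * τ) =
        (((1 / (2 * Real.pi)) ^ 2 : ℝ) : ℂ) * (Real.pi / τ) := by
      push_cast; field_simp; norm_num
    have e2 : ((Real.pi : ℂ) / (4 * Real.pi ^ 2 * τ)) ^ (1 / 2 : ℂ) = kernPre τ := by
      rw [e, kernPre, Complex.cpow_def_of_ne_zero
        (mul_ne_zero (by exact_mod_cast hr.ne') hx), Complex.log_ofReal_mul hr hx, add_mul,
        Complex.exp_add, ← Complex.cpow_def_of_ne_zero hx, Real.log_pow]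
      congr 1
      rw [show ((((2 : ℕ) : ℝ) * Real.log (1 / (2 * Real.pi)) : ℝ) : ℂ) * (1 / 2 : ℂ) =
        ((Real.log (1 / (2 * Real.pi)) : ℝ) : ℂ) by push_cast; ring, ← Complex.ofReal_exp,
        Real.exp_log (by have := Real.pi_pos; positivity)]
      push_cast
      ring
    rw [← e2, ← Complex.cpow_nat_mul]
    congr 1
    simp
    ring
  · congr 1
    have e : ‖v - w‖ ^ 2 = ∑ i, (w.ofLp - v.ofLp) i ^ 2 := by
      rw [EuclideanSpace.norm_sq_eq]
      refine Finset.sum_congr rfl fun i _ => ?_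
      rw [Real.norm_eq_abs, sq_abs]
      simp only [WithLp.ofLp_sub, Pi.sub_apply]
      ring
    rw [← e]
    push_cast
    field_simp

variable {φ : (Fin N → ℝ) → ℂ}

/-- A function of `N` coordinates as a function on the Euclidean space. -/
def onEuclidean (φ : (Fin N → ℝ) → ℂ) (v : EuclideanSpace ℝ (Fin N)) : ℂ := φ v.ofLp

lemma contDiff_onEuclidean (h : ContDiff ℝ ∞ φ) : ContDiff ℝ ∞ (onEuclidean φ) :=
  h.comp (EuclideanSpace.equiv (Fin N) ℝ).contDiff

lemma hasCompactSupport_onEuclidean (h : HasCompactSupport φ) :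
    HasCompactSupport (onEuclidean φ) :=
  h.comp_homeomorph (EuclideanSpace.equiv (Fin N) ℝ).toHomeomorph

lemma integrable_onEuclidean (h1 : ContDiff ℝ ∞ φ) (h2 : HasCompactSupport φ) :
    Integrable (onEuclidean φ) :=
  (contDiff_onEuclidean h1).continuous.integrable_of_hasCompactSupport
    (hasCompactSupport_onEuclidean h2)

lemma integrable_fourier_onEuclidean (h1 : ContDiff ℝ ∞ φ) (h2 : HasCompactSupport φ) :
    Integrable (FourierTransform.fourier (onEuclidean φ)) :=
  (FourierTransform.fourier ((hasCompactSupport_onEuclidean h2).toSchwartzMap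
    (contDiff_onEuclidean h1))).integrable

/-- The damped plane waves on the Fourier side. -/
def dualWave (τ : ℂ) (v : Fin N → ℝ) (ξ : EuclideanSpace ℝ (Fin N)) : ℂ :=
  Complex.exp (-(4 * Real.pi ^ 2 * τ) * (‖ξ‖ : ℂ) ^ 2 +
    2 * Real.pi * Complex.I * (inner ℝ (WithLp.toLp 2 v) ξ : ℝ))

lemma norm_dualWave_le {τ : ℂ} (hτ : 0 ≤ τ.re) (v : Fin N → ℝ) (ξ : EuclideanSpace ℝ (Fin N)) :
    ‖dualWave τ v ξ‖ ≤ 1 := by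
  rw [dualWave, Complex.norm_exp, Real.exp_le_one_iff]
  have e : (-(4 * Real.pi ^ 2 * τ) * (‖ξ‖ : ℂ) ^ 2 +
      2 * Real.pi * Complex.I * (inner ℝ (WithLp.toLp 2 v) ξ : ℝ) : ℂ) =
      ((-(4 * Real.pi ^ 2 * ‖ξ‖ ^ 2) : ℝ) : ℂ) * τ +
        ((2 * Real.pi * inner ℝ (WithLp.toLp 2 v) ξ : ℝ) : ℂ) * Complex.I := by
    push_cast; ring
  rw [e, Complex.add_re, Complex.re_ofReal_mul, Complex.re_ofReal_mul, Complex.I_re, mul_zero,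
    add_zero]
  have : 0 ≤ 4 * Real.pi ^ 2 * ‖ξ‖ ^ 2 * τ.re := by positivity
  linarith

lemma continuous_dualWave (τ : ℂ) (v : Fin N → ℝ) : Continuous (dualWave τ v) := by
  unfold dualWave
  fun_prop

lemma continuous_dualWave_time (v : Fin N → ℝ) (ξ : EuclideanSpace ℝ (Fin N)) :
    Continuous fun τ => dualWave τ v ξ := by
  unfold dualWave
  fun_prop

/-- The propagator is the Fourier transform of a damped plane wave; self-adjointness of the
transform moves it onto `φ`. -/
lemma integral_mul_gauss_of_re_pos (h1 : ContDiff ℝ ∞ φ) (h2 : HasCompactSupport φ) {τ : ℂ}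
    (hτ : 0 < τ.re) (v : Fin N → ℝ) :
    ∫ x, φ x * gauss τ (x - v) =
      ∫ ξ, FourierTransform.fourier (onEuclidean φ) ξ * dualWave τ v ξ := by
  have hre : 0 < (4 * Real.pi ^ 2 * τ).re := by
    have : (4 * Real.pi ^ 2 * τ : ℂ) = ((4 * Real.pi ^ 2 : ℝ) : ℂ) * τ := by push_cast; ring
    rw [this, Complex.re_ofReal_mul]
    have := Real.pi_pos
    positivity
  have hJ : Integrable (dualWave τ v) := by
    have := GaussianFourier.integrable_cexp_neg_mul_sq_norm_add hre (2 * Real.pi * Complex.I)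
      (WithLp.toLp 2 v : EuclideanSpace ℝ (Fin N))
    exact this
  have key := VectorFourier.integral_fourierIntegral_smul_eq_flip
    (L := innerₗ (EuclideanSpace ℝ (Fin N))) (μ := volume) (ν := volume)
    Real.continuous_fourierChar continuous_inner (integrable_onEuclidean h1 h2) hJ
  rw [flip_innerₗ] at key
  have e1 : ∫ x, φ x * gauss τ (x - v) = ∫ w : EuclideanSpace ℝ (Fin N),
      onEuclidean φ w * gauss τ (w.ofLp - v) :=
    ((EuclideanSpace.volume_preserving_symm_measurableEquiv_toLp (Fin N)).integral_comp'
      fun x => φ x * gauss τ (x - v)).symm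
  rw [e1]
  refine Eq.trans ?_ key.symm
  refine integral_congr_ae (ae_of_all _ fun w => ?_)
  simp only [smul_eq_mul]
  rw [← gauss_eq_fourier hτ (WithLp.toLp 2 v) w]
  rfl

lemma integral_mul_gauss (h1 : ContDiff ℝ ∞ φ) (h2 : HasCompactSupport φ) {t : ℝ} (ht : t ≠ 0)
    (v : Fin N → ℝ) :
    ∫ x, φ x * gauss (Complex.I * t) (x - v) =
      ∫ ξ, FourierTransform.fourier (onEuclidean φ) ξ * dualWave (Complex.I * t) v ξ := by
  have h0 : Complex.I * (t : ℂ) ≠ 0 := by simp [ht]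
  obtain ⟨C, hC, hev⟩ := exists_gauss_bounds N (τ₀ := Complex.I * t) (by simp) h0
  have hφ := h1.continuous.integrable_of_hasCompactSupport (μ := volume) h2
  have hF := integrable_fourier_onEuclidean h1 h2
  have hL : Tendsto (fun ε : ℝ => ∫ x, φ x * gauss (ε + Complex.I * t) (x - v)) (𝓝[>] 0)
      (𝓝 (∫ x, φ x * gauss (Complex.I * t) (x - v))) := by
    refine tendsto_integral_filter_of_dominated_convergence (fun x => ‖φ x‖ * C)
      (Eventually.of_forall fun ε => ?_) ?_ (hφ.norm.mul_const C) (ae_of_all _ fun x => ?_)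
    · exact (h1.continuous.mul ((continuous_gauss _).comp
        (continuous_id.sub continuous_const))).aestronglyMeasurable
    · filter_upwards [(tendsto_add_mul_I t).eventually hev, self_mem_nhdsWithin] with ε h hε
      refine ae_of_all _ fun x => ?_
      rw [norm_mul]
      exact mul_le_mul_of_nonneg_left (h (by simpa using (le_of_lt hε)) _).1 (norm_nonneg _)
    · exact ((continuousAt_gauss (by simp) h0 _).tendsto.comp (tendsto_add_mul_I t)).const_mul _
  have hR : Tendsto (fun ε : ℝ => ∫ ξ, FourierTransform.fourier (onEuclidean φ) ξ *
      dualWave (ε + Complex.I * t) v ξ) (𝓝[>] 0)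
      (𝓝 (∫ ξ, FourierTransform.fourier (onEuclidean φ) ξ * dualWave (Complex.I * t) v ξ)) := by
    refine tendsto_integral_filter_of_dominated_convergence
      (fun ξ => ‖FourierTransform.fourier (onEuclidean φ) ξ‖)
      (Eventually.of_forall fun ε => ?_) ?_ hF.norm (ae_of_all _ fun ξ => ?_)
    · exact hF.1.mul (continuous_dualWave _ v).aestronglyMeasurable
    · filter_upwards [self_mem_nhdsWithin] with ε hε
      refine ae_of_all _ fun ξ => ?_
      rw [norm_mul]
      exact mul_le_of_le_one_right (norm_nonneg _)
        (norm_dualWave_le (by simpa using (le_of_lt hε)) v ξ)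
    · exact (((continuous_dualWave_time v ξ).tendsto _).comp (tendsto_add_mul_I t)).const_mul _
  refine tendsto_nhds_unique hL (hR.congr' ?_)
  filter_upwards [self_mem_nhdsWithin] with ε hε
  exact (integral_mul_gauss_of_re_pos h1 h2 (by simpa using hε) v).symm

/-- Uniform in `t` and `v`, although for `N ≥ 1` the propagator itself blows up as `t → 0`; this
dominates the delay integral in that limit. -/
lemma norm_integral_mul_gauss_le (h1 : ContDiff ℝ ∞ φ) (h2 : HasCompactSupport φ) {t : ℝ}
    (ht : t ≠ 0) (v : Fin N → ℝ) :
    ‖∫ x, φ x * gauss (Complex.I * t) (x - v)‖ ≤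
      ∫ ξ, ‖FourierTransform.fourier (onEuclidean φ) ξ‖ := by
  rw [integral_mul_gauss h1 h2 ht]
  refine norm_integral_le_of_norm_le (integrable_fourier_onEuclidean h1 h2).norm
    (ae_of_all _ fun ξ => ?_)
  rw [norm_mul]
  exact mul_le_of_le_one_right (norm_nonneg _) (norm_dualWave_le (by simp) v ξ)

/-- On the Fourier side the damping tends to `1`, and Fourier inversion returns `φ v`. -/
lemma tendsto_integral_mul_gauss (h1 : ContDiff ℝ ∞ φ) (h2 : HasCompactSupport φ)
    (v : Fin N → ℝ) :
    Tendsto (fun t : ℝ => ∫ x, φ x * gauss (Complex.I * t) (x - v)) (𝓝[≠] 0) (𝓝 (φ v)) := by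
  have hF := integrable_fourier_onEuclidean h1 h2
  have hR : Tendsto (fun t : ℝ => ∫ ξ, FourierTransform.fourier (onEuclidean φ) ξ *
      dualWave (Complex.I * t) v ξ) (𝓝[≠] 0)
      (𝓝 (∫ ξ, FourierTransform.fourier (onEuclidean φ) ξ * dualWave 0 v ξ)) := by
    refine tendsto_integral_filter_of_dominated_convergence
      (fun ξ => ‖FourierTransform.fourier (onEuclidean φ) ξ‖)
      (Eventually.of_forall fun t => ?_) (Eventually.of_forall fun t => ?_) hF.norm
      (ae_of_all _ fun ξ => ?_)
    · exact hF.1.mul (continuous_dualWave _ v).aestronglyMeasurable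
    · refine ae_of_all _ fun ξ => ?_
      rw [norm_mul]
      exact mul_le_of_le_one_right (norm_nonneg _) (norm_dualWave_le (by simp) v ξ)
    · have hc : Continuous fun t : ℝ => dualWave (Complex.I * t) v ξ :=
        (continuous_dualWave_time v ξ).comp (by fun_prop)
      have := (hc.tendsto 0).mono_left (nhdsWithin_le_nhds (s := {0}ᶜ))
      simp only [Complex.ofReal_zero, mul_zero] at this
      exact this.const_mul _
  have hinv : ∫ ξ, FourierTransform.fourier (onEuclidean φ) ξ * dualWave 0 v ξ = φ v := by
    have h3 := (integrable_onEuclidean h1 h2).fourierInv_fourier_eq hF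
      (contDiff_onEuclidean h1).continuous.continuousAt (v := WithLp.toLp 2 v)
    rw [Real.fourierInv_eq'] at h3
    refine Eq.trans (integral_congr_ae (ae_of_all _ fun ξ => ?_)) h3
    simp only [dualWave, smul_eq_mul, mul_comm (Complex.exp _)]
    congr 2
    rw [real_inner_comm]
    push_cast
    ring
  rw [hinv] at hR
  refine hR.congr' ?_
  filter_upwards [self_mem_nhdsWithin] with t ht using (integral_mul_gauss h1 h2 ht v).symm

end TestFunction

/-! ### Only the identity leads back to the chamber -/

section Combinatorics

lemma momentum_entry (σ : SignedPerm N) (i : Fin N) :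
    σ.momentum (fun j => ((j : ℕ) : ℝ) + 1) i = (σ.entry i : ℝ) := by
  unfold SignedPerm.momentum SignedPerm.entry
  push_cast
  ring

/-- The equality case of the rearrangement inequality: strictness of `x` makes `π⁻¹` strictly
monotone, and such a bijection of `Fin N` is the identity. -/
lemma perm_eq_one_of_monovary {π : Equiv.Perm (Fin N)} {x : Fin N → ℝ} (hx : StrictMono x)
    (h : Monovary x ((fun i : Fin N => ((i : ℕ) : ℝ) + 1) ∘ π)) : π = 1 := by
  have hmono : StrictMono π.symm := by
    intro a b hab
    have h1 := h (i := π.symm a) (j := π.symm b) (by simpa using hab)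
    refine lt_of_le_of_ne (hx.le_iff_le.1 h1) (π.symm.injective.ne hab.ne)
  have : ⇑π.symm = id := (StrictMono.range_inj hmono strictMono_id).1 (by
    rw [π.symm.surjective.range_eq, Set.range_id])
  ext i
  have h2 := congrFun this (π i)
  simp only [Equiv.symm_apply_apply, id] at h2
  rw [← h2]; rfl

/-- If a point of the chamber is translated into the chamber by nonnegative delays at the
inversions of `σ`, then `σ` is the identity. -/
lemma eq_one_of_mem_chamber {σ : SignedPerm N} {y : Fin N → ℝ} (hy : y ∈ chamber N)
    {s : σ.inversions → ℝ} (hs : ∀ p, 0 ≤ s p)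
    (hx : σ.momentum y + σ.shift s ∈ chamber N) : σ = 1 := by
  set x := σ.momentum y + σ.shift s with hxdef
  -- With `w = (1, …, N)`, the goal is the closed chain `⟨w,x⟩ ≤ ⟨w,σy⟩ ≤ ⟨w,|σ|y⟩ ≤ ⟨w,y⟩ ≤ ⟨σw,x⟩
  -- ≤ ⟨|σ|w,x⟩ ≤ ⟨w,x⟩`, which forces equality throughout.
  let w : Fin N → ℝ := fun i => ((i : ℕ) : ℝ) + 1
  have hw : StrictMono w := fun a b hab => by
    have : ((a : ℕ) : ℝ) < ((b : ℕ) : ℝ) := by exact_mod_cast hab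
    simpa [w] using this
  have hw0 : ∀ i, 0 < w i := fun i => by positivity
  have hsum : ∀ m : Fin N → ℝ, ∑ l, m l * x l = ∑ l, m l * σ.momentum y l +
      ∑ p : σ.inversions, (((p.1.1 : ℤ) : ℝ) * m p.1.2.1 - m p.1.2.2) * s p := by
    intro m
    rw [← σ.sum_mul_shift, ← Finset.sum_add_distrib]
    exact Finset.sum_congr rfl fun l _ => by rw [hxdef, Pi.add_apply]; ring
  -- Each delay enters with coefficient `ησ(i) - σ(j)`, positive by the definition of an inversion.
  have hA : ∑ j, w j * y j ≤ ∑ l, (σ.entry l : ℝ) * x l := by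
    rw [hsum, ← σ.sum_momentum_mul_momentum w y]
    simp only [w, momentum_entry]
    refine le_add_of_nonneg_right (Finset.sum_nonneg fun p _ => mul_nonneg ?_ (hs p))
    have := (Finset.mem_filter.1 p.2).2.2
    have h : (σ.entry p.1.2.2 : ℝ) < ((p.1.1 : ℤ) : ℝ) * (σ.entry p.1.2.1 : ℝ) := by
      exact_mod_cast this
    linarith
  -- Here the coefficient is `η w_i - w_j`, negative because `i < j` and `w_i > 0`.
  have hB : ∑ l, w l * x l ≤ ∑ l, w l * σ.momentum y l := by
    rw [hsum]
    refine add_le_of_nonpos_right (Finset.sum_nonpos fun p _ =>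
      mul_nonpos_of_nonpos_of_nonneg ?_ (hs p))
    have h1 := hw (Finset.mem_filter.1 p.2).2.1
    have h2 := hw0 p.1.2.1
    rcases Int.units_eq_one_or p.1.1 with h | h <;> rw [h] <;> simp <;> linarith
  have hle : ∀ (η : ℤˣ) {r : ℝ}, 0 < r → ((η : ℤ) : ℝ) * r ≤ r := fun η r hr => by
    rcases Int.units_eq_one_or η with h | h <;> rw [h] <;> simp
    linarith
  have hC : ∑ l, w l * σ.momentum y l ≤ ∑ l, w l * y (σ.1 l) :=
    Finset.sum_le_sum fun l _ => mul_le_mul_of_nonneg_left (hle _ (hy.1 _)) (hw0 l).le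
  have hD : ∑ l, w l * y (σ.1 l) ≤ ∑ l, w l * y l :=
    (hw.monotone.monovary hy.2.monotone).sum_mul_comp_perm_le_sum_mul
  have hentry : ∀ l, (σ.entry l : ℝ) = ((σ.2 l : ℤ) : ℝ) * w (σ.1 l) := fun l => by
    simp [SignedPerm.entry, w]
  have hterm : ∀ l ∈ Finset.univ, (σ.entry l : ℝ) * x l ≤ x l * w (σ.1 l) := fun l _ => by
    rw [hentry, mul_comm]
    exact mul_le_mul_of_nonneg_left (hle _ (hw0 _)) (hx.1 l).le
  have hE := Finset.sum_le_sum hterm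
  have hmv : Monovary x w := hx.2.monotone.monovary hw.monotone
  have hF : ∑ l, x l * w (σ.1 l) ≤ ∑ l, x l * w l := hmv.sum_mul_comp_perm_le_sum_mul
  have hcomm : ∑ l, x l * w l = ∑ l, w l * x l := Finset.sum_congr rfl fun l _ => mul_comm _ _
  have hπ : σ.1 = 1 := perm_eq_one_of_monovary hx.2
    (hmv.sum_mul_comp_perm_eq_sum_mul_iff.1 (by linarith))
  -- Equality holds termwise in `⟨σw,x⟩ ≤ ⟨|σ|w,x⟩`; as `x_l > 0`, no sign can be negative.
  have hsgn := (Finset.sum_eq_sum_iff_of_le hterm).1 (by linarith)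
  refine Prod.ext hπ (funext fun l => ?_)
  have h := hsgn l (Finset.mem_univ l)
  rw [hentry, mul_comm] at h
  have h3 := mul_left_cancel₀ (hx.1 l).ne' h
  rcases Int.units_eq_one_or (σ.2 l) with h4 | h4
  · exact h4
  · rw [h4] at h3
    have := hw0 (σ.1 l)
    simp at h3
    linarith

lemma inversions_one : (1 : SignedPerm N).inversions = ∅ := by
  refine Finset.filter_eq_empty_iff.2 ?_
  rintro ⟨η, i, j⟩ _ ⟨h1, h2⟩
  have h1 : (i : ℕ) < j := h1
  rcases Int.units_eq_one_or η with rfl | rfl <;>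
    simp [SignedPerm.entry] at h2 <;> omega

end Combinatorics

/-! ### The initial condition -/

section Initial

variable {c : ℝ} (hc : 0 < c) {φ : (Fin N → ℝ) → ℂ}

include hc

lemma integral_delayAvg_mul (h1 : ContDiff ℝ ∞ φ) (h2 : HasCompactSupport φ) (σ : SignedPerm N)
    (b : Fin N → ℝ) (t : ℝ) :
    ∫ x, delayAvg c σ (gauss (Complex.I * t)) (x - b) * φ x =
      ∫ s, delayWeights c s * (∫ x, φ x * gauss (Complex.I * t) (x - (b + σ.shift s)))
        ∂delayMeasures σ.inversions := by
  have hφ := h1.continuous.integrable_of_hasCompactSupport (μ := volume) h2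
  have hI : Integrable (Function.uncurry fun (x : Fin N → ℝ) (s : σ.inversions → ℝ) =>
      delayWeights c s * (φ x * gauss (Complex.I * t) (x - (b + σ.shift s))))
      (volume.prod (delayMeasures σ.inversions)) := by
    have h3 := (hφ.mul_prod (integrable_delayWeights (ι := σ.inversions) hc)).mul_bdd
      (g := fun z : (Fin N → ℝ) × (σ.inversions → ℝ) =>
        gauss (Complex.I * t) (z.1 - (b + σ.shift z.2))) (c := ‖kernPre (Complex.I * t)‖ ^ N)
      (((continuous_gauss _).comp (continuous_fst.sub (continuous_const.add
        (σ.continuous_shift.comp continuous_snd)))).aestronglyMeasurable)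
      (ae_of_all _ fun z => norm_gauss_le (by simp) _)
    refine h3.congr (ae_of_all _ fun z => ?_)
    simp only [Function.uncurry]
    ring
  simp_rw [← integral_const_mul]
  rw [← integral_integral_swap hI]
  refine integral_congr_ae (ae_of_all _ fun x => ?_)
  simp only [delayAvg]
  rw [← integral_mul_const]
  refine integral_congr_ae (ae_of_all _ fun s => ?_)
  simp only [sub_sub]
  ring

lemma tendsto_integral_delayAvg_mul (h1 : ContDiff ℝ ∞ φ) (h2 : HasCompactSupport φ)
    (σ : SignedPerm N) (b : Fin N → ℝ) :
    Tendsto (fun t : ℝ => ∫ x, delayAvg c σ (gauss (Complex.I * t)) (x - b) * φ x) (𝓝[≠] 0)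
      (𝓝 (∫ s, delayWeights c s * φ (b + σ.shift s) ∂delayMeasures σ.inversions)) := by
  have hlim : Tendsto (fun t : ℝ => ∫ s, delayWeights c s *
      (∫ x, φ x * gauss (Complex.I * t) (x - (b + σ.shift s))) ∂delayMeasures σ.inversions) (𝓝[≠] 0)
      (𝓝 (∫ s, delayWeights c s * φ (b + σ.shift s) ∂delayMeasures σ.inversions)) := by
    refine tendsto_integral_filter_of_dominated_convergence
      (fun s => ‖delayWeights c s‖ * ∫ ξ, ‖FourierTransform.fourier (onEuclidean φ) ξ‖)
      (Eventually.of_forall fun t => ?_) ?_ ((integrable_delayWeights hc).norm.mul_const _)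
      (ae_of_all _ fun s => (tendsto_integral_mul_gauss h1 h2 _).const_mul _)
    · refine (measurable_delayWeights c).aestronglyMeasurable.mul ?_
      have hcont : Continuous fun z : (σ.inversions → ℝ) × (Fin N → ℝ) =>
          φ z.2 * gauss (Complex.I * t) (z.2 - (b + σ.shift z.1)) :=
        (h1.continuous.comp continuous_snd).mul ((continuous_gauss _).comp
          (continuous_snd.sub (continuous_const.add (σ.continuous_shift.comp continuous_fst))))
      exact hcont.stronglyMeasurable.integral_prod_right.aestronglyMeasurable
    · filter_upwards [self_mem_nhdsWithin] with t ht
      refine ae_of_all _ fun s => ?_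
      rw [norm_mul]
      exact mul_le_mul_of_nonneg_left (norm_integral_mul_gauss_le h1 h2 ht _) (norm_nonneg _)
  exact hlim.congr fun t => (integral_delayAvg_mul hc h1 h2 σ b t).symm

/-- Delays are almost surely nonnegative, so for `σ ≠ 1` the point `σy + shift(s)` misses the
support of `φ`. The identity has no inversions and hence no translation. -/
lemma integral_delayWeights_mul_eq (hφ : tsupport φ ⊆ chamber N) {y : Fin N → ℝ}
    (hy : y ∈ chamber N) (σ : SignedPerm N) :
    σ.sgn * ∫ s, delayWeights c s * φ (σ.momentum y + σ.shift s) ∂delayMeasures σ.inversions =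
      if σ = 1 then φ y else 0 := by
  by_cases h : σ = 1
  · subst h
    rw [if_pos rfl]
    have : IsEmpty (1 : SignedPerm N).inversions := Finset.isEmpty_coe_sort.2 inversions_one
    have hm : (1 : SignedPerm N).momentum y = y := by
      funext i; simp [SignedPerm.momentum]
    have hsh : ∀ s, (1 : SignedPerm N).shift s = 0 := fun s => by
      funext l
      exact Finset.sum_eq_zero fun p _ => isEmptyElim p
    have hsgn : (1 : SignedPerm N).sgn = 1 := by
      rw [SignedPerm.sgn_eq_prod]; simp
    -- Over an empty index set the Fourier identity at frequency `0` says that the total weight is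
    -- `1`.
    have hW := integral_delayWeights_mul_exp (ι := (1 : SignedPerm N).inversions) hc 0
    have hprod : ∏ p : (1 : SignedPerm N).inversions,
        scattering c ((0 : (1 : SignedPerm N).inversions → ℝ) p) = 1 :=
      Finset.prod_eq_one fun p _ => isEmptyElim p
    rw [hprod] at hW
    simp only [Pi.zero_apply, zero_mul, Finset.sum_const_zero, Complex.ofReal_zero, mul_zero,
      neg_zero, Complex.exp_zero, mul_one] at hW
    simp only [hm, hsh, add_zero]
    rw [integral_mul_const, hW, hsgn, one_mul, one_mul]
  · rw [if_neg h]
    have h0 : ∀ᵐ s ∂delayMeasures σ.inversions, ∀ p, 0 ≤ s p :=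
      Filter.eventually_all.2 fun p =>
        (Measure.tendsto_eval_ae_ae (μ := fun _ => delayMeasure) (i := p)).eventually
          ae_delayMeasure_nonneg
    rw [integral_eq_zero_of_ae, mul_zero]
    filter_upwards [h0] with s hs
    have hnot : σ.momentum y + σ.shift s ∉ tsupport φ := fun hmem =>
      h (eq_one_of_mem_chamber hy hs (hφ hmem))
    simp [image_eq_zero_of_notMem_tsupport hnot]

theorem tendsto_integral_wave_mul (h1 : ContDiff ℝ ∞ φ) (h2 : HasCompactSupport φ)
    (hφ : tsupport φ ⊆ chamber N) {y : Fin N → ℝ} (hy : y ∈ chamber N) :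
    Tendsto (fun t : ℝ => ∫ x, wave c y x t * φ x) (𝓝[≠] 0) (𝓝 (φ y)) := by
  have h := tendsto_finsetSum (Finset.univ : Finset (SignedPerm N)) fun σ _ =>
    (tendsto_integral_delayAvg_mul hc h1 h2 σ (σ.momentum y)).const_mul σ.sgn
  simp only [integral_delayWeights_mul_eq hc hφ hy, Finset.sum_ite_eq', Finset.mem_univ,
    if_true] at h
  refine h.congr' ?_
  filter_upwards [self_mem_nhdsWithin] with t ht
  have hint : ∀ σ : SignedPerm N, Integrable fun x =>
      σ.sgn * (delayAvg c σ (gauss (Complex.I * t)) (x - σ.momentum y) * φ x) := fun σ =>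
    (((contDiff_delayAvg_gauss hc σ (σ.momentum y) ht).continuous.mul
      h1.continuous).integrable_of_hasCompactSupport h2.mul_left).const_mul _
  simp_rw [← integral_const_mul]
  rw [← integral_finsetSum _ fun σ _ => hint σ]
  refine integral_congr_ae (ae_of_all _ fun x => ?_)
  simp only [wave, Finset.sum_mul, mul_assoc]

end Initial

/-- For `t ≠ 0`, `Psi` equals `wave` at every point of space, so derivatives agree. The limits at
the boundary are values of a function smooth across it. -/
theorem isSolution_Psi {c : ℝ} (hc : 0 < c) {y : Fin N → ℝ} (hy : y ∈ chamber N) :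
    IsSolution c y (Psi c y) where
  regular := by
    refine (((contDiffOn_wave hc y).of_le (mod_cast le_top : ((2 : ℕ∞) : WithTop ℕ∞) ≤ ∞)).mono
      (Set.prod_mono (Set.subset_univ _) le_rfl)).congr fun p hp => Psi_eq_wave hc y p.1 hp.2
  schrodinger x _ t ht := by
    have h1 : (fun z => Psi c y z t) = fun z => wave c y z t :=
      funext fun z => Psi_eq_wave hc y z ht
    have h2 : Psi c y x =ᶠ[𝓝 t] wave c y x := by
      filter_upwards [isOpen_ne.mem_nhds ht] with r hr using Psi_eq_wave hc y x hr
    rw [h1, h2.deriv_eq]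
    exact schrodinger_wave hc y x ht
  interaction t ht i j hij z _ hz := by
    have h1 : (fun z => Psi c y z t) = fun z => wave c y z t :=
      funext fun z => Psi_eq_wave hc y z ht
    have hs := contDiff_wave hc y ht
    rw [h1]
    refine ⟨wave c y z t, (hs.continuous.tendsto z).mono_left nhdsWithin_le_nhds, ?_⟩
    rw [← partialDeriv_wave_sub hc y ht hij hz]
    exact (((contDiff_partialDeriv hs j).continuous.sub
      (contDiff_partialDeriv hs i).continuous).tendsto z).mono_left nhdsWithin_le_nhds
  hardWall t ht i hi z _ hz := by
    have h1 : (fun z => Psi c y z t) = fun z => wave c y z t :=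
      funext fun z => Psi_eq_wave hc y z ht
    rw [h1, ← wave_eq_zero hc y ht hi hz]
    exact ((contDiff_wave hc y ht).continuous.tendsto z).mono_left nhdsWithin_le_nhds
  initial φ h1 h2 hφ := by
    refine (tendsto_integral_wave_mul hc h1 h2 hφ hy).congr' ?_
    filter_upwards [self_mem_nhdsWithin] with t ht
    simp only [Psi_eq_wave hc y _ ht]

end

end HalfLineBose

/-- The improper integrals in `Ψ_y(x; t)` converge, and `Ψ_y` solves the problem. -/
theorem mainTheorem1 (N : ℕ) (c : ℝ) (hc : 0 < c) (y : Fin N → ℝ)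
    (hy : y ∈ HalfLineBose.chamber N) :
    (∀ x ∈ HalfLineBose.chamber N, ∀ t : ℝ, t ≠ 0 → ∀ σ : HalfLineBose.SignedPerm N,
      ∃ I : ℂ, Tendsto (HalfLineBose.boxIntegral c σ y x t) (HalfLineBose.boxFilter N) (𝓝 I)) ∧
    HalfLineBose.IsSolution c y (HalfLineBose.Psi c y) :=
  ⟨fun x _ _ ht σ => ⟨_, HalfLineBose.tendsto_boxIntegral hc σ y x ht⟩,
    HalfLineBose.isSolution_Psi hc hy⟩
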